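/- Let $(V,Y,\mathbf 1,\omega)$ be a vertex operator algebra over $\mathbb C$ and let $W_1,W_2$ be $V$-modules ($\mathbb C$-graded by finite-dimensional $L(0)$-eigenspaces, with the grading bounded below on each coset of $\mathbb Z$ in $\mathbb C$). Write $Y_{W_i}(a,x)=\sum_{n\in\mathbb Z}a_nx^{-n-1}$ and $L(-1)=\omega_0$. For a formal series $\Phi(x)=\sum_{\alpha\in\mathbb C}\Phi_\alpha x^{-\alpha-1}\in \mathrm{Hom}(W_1,W_2)\{x\}$ consider the conditions: (G1) for all $\alpha\in\mathbb C$, $u\in W_1$: $\Phi_{\alpha+n}u=0$ for all sufficiently large $n\in\mathbb Z$; (G2) $L(-1)\Phi(x)-\Phi(x)L(-1)=\frac{d}{dx}\Phi(x)$; (G3) for every $a\in V$ there is a positive integer $k$ with $(x_1-x_2)^kY_{W_2}(a,x_1)\Phi(x_2)=(x_1-x_2)^k\Phi(x_2)Y_{W_1}(a,x_1)$. Let $W(W_1,W_2)$, $E(W_1,W_2)$ and $G(W_1,W_2)$ be the vector spaces of the series satisfying (G1), satisfying (G1) and (G3), and satisfying (G1), (G2) and (G3), respectively. For $a\in V$,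 $m\in\mathbb Z$ and $\Phi\in W(W_1,W_2)$ define $a(m)\circ\Phi\in W(W_1,W_2)$ by $$a(m)\circ\Phi(x_2)=\mathrm{Res}_{x_1}\Big((x_1-x_2)^mY_{W_2}(a,x_1)\Phi(x_2)-(-x_2+x_1)^m\Phi(x_2)Y_{W_1}(a,x_1)\Big),$$ where $(x_1-x_2)^m$ is expanded in nonnegative powers of $x_2$ and $(-x_2+x_1)^m$ in nonnegative powers of $x_1$. Theorem. $E(W_1,W_2)$ and $G(W_1,W_2)$ are stable under all the operators $a(m)\circ$, and each of them is a weak $V$-module with vertex operators $Y(a,x)=\sum_{m\in\mathbb Z}(a(m)\circ)\,x^{-m-1}$. That is, on $M=E(W_1,W_2)$ and on $M=G(W_1,W_2)$ the map $a\mapsto Y_M(a,x)=Y(a,x)$ is linear and satisfies: $Y_M(\mathbf 1,x)=1$; $Y_M(L(-1)a,x)=\frac{d}{dx}Y_M(a,x)$; $Y_M(a,x)\Phi\in M((x))$ for all $a\in V$, $\Phi\in M$; and the Jacobi identity $$x_0^{-1}\delta\Big(\frac{x_1-x_2}{x_0}\Big)Y_M(a,x_1)Y_M(b,x_2)\Phi-x_0^{-1}\delta\Big(\frac{-x_2+x_1}{x_0}\Big)Y_M(b,x_2)Y_M(a,x_1)\Phi=x_2^{-1}\delta\Big(\frac{x_1-x_0}{x_2}\Big)Y_M(Y(a,x_0)b,x_2)\Phi$$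 for all $a,b\in V$, $\Phi\in M$. -/

import Mathlib

noncomputable section

/-- `(-1)^i * C(l, i)`: the coefficient of `z^(l-i) y^i` in `(z - y)^l`, expanded in nonnegative
powers of the second variable `y` (`l` is any integer). -/
def binomSub (l : ℤ) (i : ℕ) : ℂ :=
  (-1 : ℂ) ^ i * ((Ring.choose l i : ℤ) : ℂ)

/-- `(-1)^(l-i) * C(l, i)`: the coefficient of `z^(l-i) y^i` in `(-z + y)^l`, expanded in
nonnegative powers of the second variable `y` (`l` is any integer). -/
def binomNegAdd (l : ℤ) (i : ℕ) : ℂ :=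
  (-1 : ℂ) ^ (l - (i : ℤ)) * ((Ring.choose l i : ℤ) : ℂ)

/-- A linear map `Y(·, x) : V → (End M)[[x, x⁻¹]]`, given by its modes:
`Y(a, x) = ∑ₙ (Y a n) x^(-n-1)`. -/
abbrev ModeMap (V M : Type*) [AddCommGroup V] [Module ℂ V] [AddCommGroup M] [Module ℂ M] :=
  V →ₗ[ℂ] ℤ → Module.End ℂ M

/-- `Y(a, x) u ∈ M((x))` for all `a` and `u`. -/
def IsTruncated {V M : Type*} [AddCommGroup V] [Module ℂ V] [AddCommGroup M] [Module ℂ M]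
    (Y : ModeMap V M) : Prop :=
  ∀ (a : V) (u : M), ∃ N : ℤ, ∀ n : ℤ, N ≤ n → Y a n u = 0

/-- The Jacobi identity
`x₀⁻¹ δ((x₁-x₂)/x₀) Y_M(a,x₁) Y_M(b,x₂) u - x₀⁻¹ δ((-x₂+x₁)/x₀) Y_M(b,x₂) Y_M(a,x₁) u
  = x₂⁻¹ δ((x₁-x₀)/x₂) Y_M(Y(a,x₀)b, x₂) u`,
that is, equality of the coefficients of `x₀^(-l-1) x₁^(-m-1) x₂^(-n-1)` on both sides for all
integers `l, m, n`. On the right the coefficient `(-1)^i C(i-m-1, i)` coming from the expansion of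
the delta function is written as `C(m, i)`. All the sums are finite when `Y` and `YM` are
truncated. -/
def JacobiIdentity {V M : Type*} [AddCommGroup V] [Module ℂ V] [AddCommGroup M] [Module ℂ M]
    (Y : ModeMap V V) (YM : ModeMap V M) : Prop :=
  ∀ (a b : V) (u : M) (l m n : ℤ),
    (∑ᶠ i : ℕ, binomSub l i • YM a (m + l - i) (YM b (n + i) u))
      - (∑ᶠ i : ℕ, binomNegAdd l i • YM b (n + l - i) (YM a (m + i) u))
    = ∑ᶠ i : ℕ, ((Ring.choose m i : ℤ) : ℂ) • YM (Y a (l + i) b) (m + n - i) u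

/-- A vertex operator algebra structure `(V, Y, 𝟏, ω)` on a complex vector space. -/
structure VertexOperatorAlgebra (V : Type*) [AddCommGroup V] [Module ℂ V] where
  /-- the homogeneous subspaces `V_(n)` -/
  gr : ℤ → Submodule ℂ V
  Y : ModeMap V V
  vac : V
  omega : V
  rank : ℂ
  gr_isInternal : DirectSum.IsInternal gr
  gr_finite : ∀ n, Module.Finite ℂ (gr n)
  gr_bounded : ∃ N : ℤ, ∀ n : ℤ, n < N → gr n = ⊥
  /-- `Y(𝟏, x) = 1` -/
  Y_vac : ∀ n : ℤ, Y vac n = if n = -1 then 1 else 0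
  /-- `Y(a, x)𝟏` has no negative powers of `x` -/
  creation_nonneg : ∀ (a : V) (n : ℤ), 0 ≤ n → Y a n vac = 0
  /-- the constant term of `Y(a, x)𝟏` is `a` -/
  creation : ∀ a : V, Y a (-1) vac = a
  truncated : IsTruncated Y
  jacobi : JacobiIdentity Y Y
  /-- the Virasoro relations for `L(n) = ω_{n+1}`, i.e. `Y(ω, x) = ∑ₙ L(n) x^(-n-2)` -/
  virasoro : ∀ m n : ℤ,
    Y omega (m + 1) * Y omega (n + 1) - Y omega (n + 1) * Y omega (m + 1)
      = ((m : ℂ) - (n : ℂ)) • Y omega (m + n + 1)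
        + (if m + n = 0 then ((m : ℂ) ^ 3 - (m : ℂ)) / 12 * rank else 0) • (1 : Module.End ℂ V)
  /-- `Y(L(-1)a, x) = d/dx Y(a, x)` -/
  derivative : ∀ (a : V) (n : ℤ), Y (Y omega 0 a) n = (-(n : ℂ)) • Y a (n - 1)
  /-- `L(0) u = n u` for `u ∈ V_(n)` -/
  L_zero : ∀ (n : ℤ), ∀ u ∈ gr n, Y omega 1 u = (n : ℂ) • u

/-- `(M, Y_M)` is a weak module for the vertex operator algebra `𝒱`. No grading is required. -/
structure IsWeakModule {V : Type*} [AddCommGroup V] [Module ℂ V] (𝒱 : VertexOperatorAlgebra V)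
    {M : Type*} [AddCommGroup M] [Module ℂ M] (YM : ModeMap V M) : Prop where
  /-- `Y_M(𝟏, x) = 1` -/
  Y_vac : ∀ n : ℤ, YM 𝒱.vac n = if n = -1 then 1 else 0
  /-- `Y_M(L(-1)a, x) = d/dx Y_M(a, x)` -/
  derivative : ∀ (a : V) (n : ℤ), YM (𝒱.Y 𝒱.omega 0 a) n = (-(n : ℂ)) • YM a (n - 1)
  truncated : IsTruncated YM
  jacobi : JacobiIdentity 𝒱.Y YM

/-- A module for a vertex operator algebra: a weak module with a `ℂ`-grading by finite-dimensional
eigenspaces of `L(0) = ω_1`, bounded below on every coset of `ℤ` in `ℂ`. -/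
structure VOAModule {V : Type*} [AddCommGroup V] [Module ℂ V] (𝒱 : VertexOperatorAlgebra V)
    (M : Type*) [AddCommGroup M] [Module ℂ M] where
  Y : ModeMap V M
  isWeakModule : IsWeakModule 𝒱 Y
  /-- the homogeneous subspaces `M_(h)` -/
  gr : ℂ → Submodule ℂ M
  gr_isInternal : DirectSum.IsInternal gr
  L_zero : ∀ (h : ℂ), ∀ u ∈ gr h, Y 𝒱.omega 1 u = h • u
  gr_finite : ∀ h, Module.Finite ℂ (gr h)
  gr_bounded : ∀ h : ℂ, ∃ N : ℤ, ∀ n : ℤ, n < N → gr ((n : ℂ) + h) = ⊥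

/-- The space `Hom(M₁, M₂){x}` of formal series `Φ(x) = ∑_{α ∈ ℂ} Φ_α x^(-α-1)`, given by
`α ↦ Φ_α`. -/
abbrev HomSeries (M₁ M₂ : Type*) [AddCommGroup M₁] [Module ℂ M₁] [AddCommGroup M₂]
    [Module ℂ M₂] :=
  ℂ → M₁ →ₗ[ℂ] M₂

/-- The space `W(M₁, M₂)` of the series in `Hom(M₁, M₂){x}` with the truncation property (G1): for
all `α ∈ ℂ` and `u`, `Φ_{α+n} u = 0` for every sufficiently large integer `n`. -/
def truncSeries (M₁ M₂ : Type*) [AddCommGroup M₁] [Module ℂ M₁] [AddCommGroup M₂]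
    [Module ℂ M₂] : Submodule ℂ (HomSeries M₁ M₂) where
  carrier := {Φ | ∀ (α : ℂ) (u : M₁), ∃ N : ℤ, ∀ n : ℤ, N ≤ n → Φ (α + n) u = 0}
  zero_mem' _ _ := ⟨0, fun _ _ => rfl⟩
  add_mem' {Φ Ψ} hΦ hΨ α u := by
    obtain ⟨N, hN⟩ := hΦ α u
    obtain ⟨N', hN'⟩ := hΨ α u
    refine ⟨max N N', fun n hn => ?_⟩
    simp [hN n (le_trans (le_max_left _ _) hn), hN' n (le_trans (le_max_right _ _) hn)]
  smul_mem' c Φ hΦ α u := by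
    obtain ⟨N, hN⟩ := hΦ α u
    exact ⟨N, fun n hn => by simp [hN n hn]⟩

/-- Multiplication by `x₁ - x₂` on formal series
`∑_{m ∈ ℤ, α ∈ ℂ} f_{m,α} x₁^(-m-1) x₂^(-α-1)` with coefficients in `Hom(M₁, M₂)`. -/
def mulSub (M₁ M₂ : Type*) [AddCommGroup M₁] [Module ℂ M₁] [AddCommGroup M₂] [Module ℂ M₂] :
    Module.End ℂ (ℤ → ℂ → M₁ →ₗ[ℂ] M₂) where
  toFun f m α := f (m + 1) α - f m (α + 1)
  map_add' f g := by
    funext m α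
    simp only [Pi.add_apply]
    abel
  map_smul' c f := by
    funext m α
    simp [smul_sub]

/-- The sum of a pointwise finite family of linear maps. -/
def pointwiseSum {M₁ M₂ : Type*} [AddCommGroup M₁] [Module ℂ M₁] [AddCommGroup M₂] [Module ℂ M₂]
    (f : ℕ → M₁ →ₗ[ℂ] M₂) (hf : ∀ u, (Function.support fun i => f i u).Finite) :
    M₁ →ₗ[ℂ] M₂ where
  toFun u := ∑ᶠ i, f i u
  map_add' u v := by
    simp only [map_add]
    exact finsum_add_distrib (hf u) (hf v)
  map_smul' c u := by
    simp only [map_smul, RingHom.id_apply]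
    exact (smul_finsum' c (hf u)).symm

theorem finite_support_of_eventually_zero {M : Type*} [AddCommGroup M] {f : ℕ → M} {N : ℤ}
    (h : ∀ i : ℕ, N ≤ i → f i = 0) : (Function.support f).Finite := by
  refine (Set.finite_lt_nat N.toNat).subset fun i hi => ?_
  by_contra hlt
  have : ¬ i < N.toNat := hlt
  exact hi (h i (by omega))

variable {V : Type*} [AddCommGroup V] [Module ℂ V] {𝒱 : VertexOperatorAlgebra V}
  {M₁ M₂ : Type*} [AddCommGroup M₁] [Module ℂ M₁] [AddCommGroup M₂] [Module ℂ M₂]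

namespace VOAModule

/-- The coefficient of `x₂^(-α-1)` in `Res_{x₁} (x₁ - x₂)^m Y_{W₂}(a, x₁) Φ(x₂)`. -/
def leftAction (W₂ : VOAModule 𝒱 M₂) (a : V) (m : ℤ) (Φ : truncSeries M₁ M₂) (α : ℂ) :
    M₁ →ₗ[ℂ] M₂ :=
  pointwiseSum (fun i : ℕ => binomSub m i • (W₂.Y a (m - i) ∘ₗ Φ.1 (α + i))) fun u => by
    obtain ⟨N, hN⟩ := Φ.2 α u
    refine finite_support_of_eventually_zero (N := N) fun i hi => ?_
    have := hN i hi
    simp only [Int.cast_natCast] at this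
    simp [this]

/-- The coefficient of `x₂^(-α-1)` in `Res_{x₁} (-x₂ + x₁)^m Φ(x₂) Y_{W₁}(a, x₁)`. -/
def rightAction (W₁ : VOAModule 𝒱 M₁) (a : V) (m : ℤ) (Φ : truncSeries M₁ M₂) (α : ℂ) :
    M₁ →ₗ[ℂ] M₂ :=
  pointwiseSum (fun i : ℕ => binomNegAdd m i • (Φ.1 (α + m - i) ∘ₗ W₁.Y a i)) fun u => by
    obtain ⟨N, hN⟩ := W₁.isWeakModule.truncated a u
    exact finite_support_of_eventually_zero (N := N) fun i hi => by simp [hN i hi]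

/-- The action
`a(m) ∘ Φ(x₂) = Res_{x₁} ((x₁-x₂)^m Y_{W₂}(a,x₁) Φ(x₂) - (-x₂+x₁)^m Φ(x₂) Y_{W₁}(a,x₁))`
on `W(W₁, W₂)`. -/
def circ (W₁ : VOAModule 𝒱 M₁) (W₂ : VOAModule 𝒱 M₂) (a : V) (m : ℤ)
    (Φ : truncSeries M₁ M₂) : truncSeries M₁ M₂ :=
  ⟨fun α => W₂.leftAction a m Φ α - W₁.rightAction a m Φ α, by
    intro α u
    obtain ⟨N, hN⟩ := Φ.2 α u
    obtain ⟨K, hK⟩ := W₁.isWeakModule.truncated a u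
    choose B hB using fun i : ℕ => Φ.2 α (W₁.Y a i u)
    let C : ℤ := ∑ i ∈ Finset.range K.toNat, (|B i| + |m| + i)
    refine ⟨max N C, fun n hn => ?_⟩
    have h1 : W₂.leftAction a m Φ (α + n) u = 0 := by
      refine finsum_eq_zero_of_forall_eq_zero fun i => ?_
      have h := hN (n + i) (by have := le_max_left N C; omega)
      push_cast at h
      rw [← add_assoc] at h
      simp [h]
    have h2 : W₁.rightAction a m Φ (α + n) u = 0 := by
      refine finsum_eq_zero_of_forall_eq_zero fun i => ?_
      by_cases hi : K ≤ i
      · simp [hK i hi]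
      · have hle : |B i| + |m| + i ≤ C :=
          Finset.single_le_sum (f := fun i : ℕ => |B i| + |m| + (i : ℤ))
            (fun j _ => by positivity) (Finset.mem_range.2 (by omega))
        have h := hB i (n + m - i) (by
          have := le_max_right N C
          have := le_abs_self (B i)
          have := neg_abs_le m
          omega)
        have e : α + (n : ℂ) + m - i = α + ((n + m - i : ℤ) : ℂ) := by push_cast; ring
        rw [← e] at h
        simp only [LinearMap.smul_apply, LinearMap.comp_apply, h, smul_zero]
    simp [h1, h2]⟩

/-- The locality property (G3): for every `a ∈ V` there is a positive integer `k` with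
`(x₁-x₂)^k Y_{W₂}(a,x₁) Φ(x₂) = (x₁-x₂)^k Φ(x₂) Y_{W₁}(a,x₁)`. -/
def IsLocal (W₁ : VOAModule 𝒱 M₁) (W₂ : VOAModule 𝒱 M₂) (Φ : HomSeries M₁ M₂) : Prop :=
  ∀ a : V, ∃ k : ℕ, 0 < k ∧
    (mulSub M₁ M₂ ^ k) (fun m α => W₂.Y a m ∘ₗ Φ α)
      = (mulSub M₁ M₂ ^ k) (fun m α => Φ α ∘ₗ W₁.Y a m)

/-- The `L(-1)`-bracket formula (G2): `[L(-1), Φ(x)] = d/dx Φ(x)`, where `L(-1) = ω_0`. -/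
def HasDerivBracket (W₁ : VOAModule 𝒱 M₁) (W₂ : VOAModule 𝒱 M₂) (Φ : HomSeries M₁ M₂) : Prop :=
  ∀ α : ℂ, W₂.Y 𝒱.omega 0 ∘ₗ Φ α - Φ α ∘ₗ W₁.Y 𝒱.omega 0 = (-α) • Φ (α - 1)

theorem mulSub_pow_mono {k k' : ℕ} (hk : k ≤ k') {f g : ℤ → ℂ → M₁ →ₗ[ℂ] M₂}
    (h : (mulSub M₁ M₂ ^ k) f = (mulSub M₁ M₂ ^ k) g) :
    (mulSub M₁ M₂ ^ k') f = (mulSub M₁ M₂ ^ k') g := by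
  obtain ⟨j, rfl⟩ := Nat.exists_eq_add_of_le' hk
  rw [pow_add, Module.End.mul_apply, Module.End.mul_apply, h]

/-- The space `E(W₁, W₂)` of the elements of `W(W₁, W₂)` with the locality property (G3). -/
def localSeries (W₁ : VOAModule 𝒱 M₁) (W₂ : VOAModule 𝒱 M₂) :
    Submodule ℂ (truncSeries M₁ M₂) where
  carrier := {Φ | IsLocal W₁ W₂ Φ.1}
  zero_mem' a := ⟨1, one_pos, by simp⟩
  add_mem' {Φ Ψ} hΦ hΨ a := by
    obtain ⟨k, hk, h⟩ := hΦ a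
    obtain ⟨k', _, h'⟩ := hΨ a
    refine ⟨max k k', lt_of_lt_of_le hk (le_max_left _ _), ?_⟩
    have e := congrArg₂ (· + ·) (mulSub_pow_mono (le_max_left k k') h)
      (mulSub_pow_mono (le_max_right k k') h')
    simp only [← map_add] at e
    have hl : (fun (m : ℤ) (α : ℂ) => W₂.Y a m ∘ₗ (Φ + Ψ).1 α)
        = (fun m α => W₂.Y a m ∘ₗ Φ.1 α) + fun m α => W₂.Y a m ∘ₗ Ψ.1 α := by
      funext m α; ext u; simp
    have hr : (fun (m : ℤ) (α : ℂ) => (Φ + Ψ).1 α ∘ₗ W₁.Y a m)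
        = (fun m α => Φ.1 α ∘ₗ W₁.Y a m) + fun m α => Ψ.1 α ∘ₗ W₁.Y a m := by
      funext m α; ext u; simp
    rw [hl, hr]
    exact e
  smul_mem' c Φ hΦ a := by
    obtain ⟨k, hk, h⟩ := hΦ a
    refine ⟨k, hk, ?_⟩
    have e := congrArg (c • ·) h
    simp only [← map_smul] at e
    have hl : (fun (m : ℤ) (α : ℂ) => W₂.Y a m ∘ₗ (c • Φ).1 α)
        = c • fun m α => W₂.Y a m ∘ₗ Φ.1 α := by
      funext m α; ext u; simp
    have hr : (fun (m : ℤ) (α : ℂ) => (c • Φ).1 α ∘ₗ W₁.Y a m)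
        = c • fun m α => Φ.1 α ∘ₗ W₁.Y a m := by
      funext m α; ext u; simp
    rw [hl, hr]
    exact e

/-- The space `G(W₁, W₂)` of generalized intertwining operators: the elements of `W(W₁, W₂)` with
the `L(-1)`-bracket formula (G2) and the locality property (G3). -/
def genIntertwining (W₁ : VOAModule 𝒱 M₁) (W₂ : VOAModule 𝒱 M₂) :
    Submodule ℂ (truncSeries M₁ M₂) where
  carrier := {Φ | HasDerivBracket W₁ W₂ Φ.1 ∧ IsLocal W₁ W₂ Φ.1}
  zero_mem' := ⟨fun α => by simp, (localSeries W₁ W₂).zero_mem⟩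
  add_mem' {Φ Ψ} hΦ hΨ := ⟨fun α => by
    have h := congrArg₂ (· + ·) (hΦ.1 α) (hΨ.1 α)
    simp only [← smul_add] at h
    refine Eq.trans ?_ h
    ext u
    simp
    abel, (localSeries W₁ W₂).add_mem hΦ.2 hΨ.2⟩
  smul_mem' c Φ hΦ := ⟨fun α => by
    have h := congrArg (c • ·) (hΦ.1 α)
    simp only [smul_comm c (-α)] at h
    refine Eq.trans ?_ h
    ext u
    simp [smul_sub], (localSeries W₁ W₂).smul_mem c hΦ.2⟩

end VOAModule

end

/-!
Why the theorem holds. Fix `a, b ∈ V`, a local series `Φ` and a vector `u`, and consider the double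
commutators `[Y(a, x₁), [Y(b, x₂), Φ(z)]] u` and `[Y(b, x₂), [Y(a, x₁), Φ(z)]] u`. Each of the six
products of the three operators lives in a space of iterated Laurent series on which `x₁ - x₂`,
`x₁ - z` and `x₂ - z` act invertibly (`isUnit₁₂`, `isUnit₁₃`, `isUnit₂₃`), so it can be multiplied
by `(x₁ - x₂)^l (x₁ - z)^m (x₂ - z)^n` for all integers `l, m, n`. Summing with signs gives two
families `S l m n` and `T l m n`, and everything follows from four facts (`IsCommutatorPair`,
`exists_isCommutatorPair`):

* both satisfy `S (l+1) m n = S l (m+1) n - S l m (n+1)`, because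
  `x₁ - x₂ = (x₁ - z) - (x₂ - z)`;
* the residues of `S 0 m n` and `T 0 m n` are `a(m)∘(b(n)∘Φ)` and `b(n)∘(a(m)∘Φ)`;
* the double commutators satisfy `S - T = [[Y(a, x₁), Y(b, x₂)], Φ(z)] u`, so that by the iterate
  formula on `W₁` and `W₂` the residue of `S l 0 n - T l 0 n` is `(a_l b)(n)∘Φ`;
* by locality `S` vanishes for large `n`, `T` for large `m` and `S - T` for large `l`. The reason is
  that locality is a statement on two orders that differ by a transposition of neighbours, and for
  such a pair the expansions of the other two differences agree.

A family with this recursion that is truncated in one of its exponents is determined by its members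
where another exponent is zero, through a binomial expansion (`eq_finsum_binomSub`,
`eq_finsum_binomNegAdd`, `eq_finsum_choose`). Applied to `S`, `T` and `S - T`, at the exponents
`(l, m, n)`, this gives the three sums of the Jacobi identity (`circ_jacobi`). The same recursion
and the same vanishing show that `S 0 m n = 0` for large `m`, which is the locality of `b(n)∘Φ`
(`isLocal_circ`), and the pair `a, 𝟏` gives the truncation `a(m)∘Φ = 0` for large `m`. The vacuum
and derivative properties and the stability of the `L(-1)`-bracket formula are termwise
computations with binomial coefficients.
-/

/-! ### Expansions of integer powers of a difference -/

theorem binomSub_zero_right (l : ℤ) : binomSub l 0 = 1 := by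
  simp [binomSub]

theorem binomSub_zero_succ (i : ℕ) : binomSub 0 (i + 1) = 0 := by
  simp [binomSub, Ring.choose_zero_succ]

theorem binomSub_succ_succ (l : ℤ) (i : ℕ) :
    binomSub (l + 1) (i + 1) = binomSub l (i + 1) - binomSub l i := by
  simp only [binomSub, Ring.choose_succ_succ]
  push_cast
  ring

theorem binomNegAdd_eq (l : ℤ) (i : ℕ) : binomNegAdd l i = (-1) ^ l * binomSub l i := by
  rw [binomNegAdd, binomSub, ← mul_assoc, zpow_sub₀ (by norm_num), zpow_natCast, div_eq_mul_inv,
    ← inv_pow]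
  norm_num

section Recursion

variable {M : Type*} [AddCommGroup M]

theorem finsum_eq_sum_range {f : ℕ → M} {N : ℕ} (h : ∀ k, N ≤ k → f k = 0) :
    ∑ᶠ k, f k = ∑ k ∈ Finset.range N, f k :=
  finsum_eq_sum_of_support_subset _ fun k hk => by
    by_contra hlt
    exact hk (h k (by simpa using hlt))

/-- A family with the recursion of the powers `(x - y)^l x^m y^n` that vanishes for `l = 0` and is
truncated in `y` is zero: for negative `l` the recursion moves the indices `(m, n)` to
`(m - k, n + k)`. -/
theorem eq_zero_of_recursion {D : ℤ → ℤ → ℤ → M}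
    (hrec : ∀ l m n, D (l + 1) m n = D l (m + 1) n - D l m (n + 1))
    (h0 : ∀ m n, D 0 m n = 0)
    (htr : ∀ l m n, ∃ N : ℕ, ∀ k : ℕ, N ≤ k → D l (m - k) (n + k) = 0) (l m n : ℤ) :
    D l m n = 0 := by
  induction l using Int.induction_on generalizing m n with
  | zero => exact h0 m n
  | succ l ih => rw [hrec, ih, ih, sub_zero]
  | pred l ih =>
    have hstep : ∀ m n, D (-(l : ℤ) - 1) (m + 1) n = D (-(l : ℤ) - 1) m (n + 1) := fun m n => by
      have h := hrec (-(l : ℤ) - 1) m n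
      rw [sub_add_cancel, ih] at h
      exact (sub_eq_zero.1 h.symm)
    have hmove : ∀ k : ℕ, D (-(l : ℤ) - 1) m n = D (-(l : ℤ) - 1) (m - k) (n + k) := by
      intro k
      induction k with
      | zero => simp
      | succ k ihk =>
        rw [ihk]
        have h := hstep (m - (k + 1 : ℕ)) (n + k)
        push_cast at h ⊢
        rw [← add_assoc, ← h]
        congr 1
        ring
    obtain ⟨N, hN⟩ := htr (-(l : ℤ) - 1) m n
    rw [hmove N, hN N le_rfl]

variable [Module ℂ M]

/-- The expansion of `(x - y)^(l+1)` is `x - y` times that of `(x - y)^l`. -/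
theorem finsum_binomSub_succ {H : ℤ → ℤ → M}
    (hH : ∀ m n : ℤ, ∃ N : ℕ, ∀ k : ℕ, N ≤ k → H (m - k) (n + k) = 0) (l m n : ℤ) :
    ∑ᶠ i : ℕ, binomSub (l + 1) i • H (m + (l + 1) - i) (n + i)
      = ∑ᶠ i : ℕ, binomSub l i • H (m + 1 + l - i) (n + i)
        - ∑ᶠ i : ℕ, binomSub l i • H (m + l - i) (n + 1 + i) := by
  obtain ⟨N, hN⟩ := hH (m + (l + 1)) n
  have e1 : ∀ k : ℕ, m + 1 + l - k = m + (l + 1) - k := fun k => by ring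
  have h2 : ∀ k : ℕ, m + l - (k : ℤ) = m + (l + 1) - ((k + 1 : ℕ) : ℤ) := fun k => by
    push_cast; ring
  have h3 : ∀ k : ℕ, n + 1 + (k : ℤ) = n + ((k + 1 : ℕ) : ℤ) := fun k => by push_cast; ring
  simp only [e1, h2, h3]
  rw [finsum_eq_sum_range (N := N + 1) fun k hk => by rw [hN k (by omega), smul_zero],
    finsum_eq_sum_range (N := N + 1) fun k hk => by rw [hN k (by omega), smul_zero],
    finsum_eq_sum_range (N := N) fun k hk => by rw [hN (k + 1) (by omega), smul_zero],
    Finset.sum_range_succ', Finset.sum_range_succ']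
  simp only [binomSub_succ_succ, sub_smul, Finset.sum_sub_distrib, binomSub_zero_right]
  abel

/-- A family with the recursion of `(x - y)^l x^m y^n` that is truncated in `y` is given by the
expansion of `(x - y)^l` in nonnegative powers of `y`. -/
theorem eq_finsum_binomSub {G : ℤ → ℤ → ℤ → M}
    (hrec : ∀ l m n, G (l + 1) m n = G l (m + 1) n - G l m (n + 1))
    (htr : ∀ l m n, ∃ N : ℕ, ∀ k : ℕ, N ≤ k → G l (m - k) (n + k) = 0) (l m n : ℤ) :
    G l m n = ∑ᶠ i : ℕ, binomSub l i • G 0 (m + l - i) (n + i) := by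
  rw [← sub_eq_zero]
  refine eq_zero_of_recursion
    (D := fun l m n => G l m n - ∑ᶠ i : ℕ, binomSub l i • G 0 (m + l - i) (n + i))
    (fun l m n => ?_) (fun m n => ?_) (fun l m n => ?_) l m n
  · rw [hrec, finsum_binomSub_succ (htr 0)]
    abel
  · rw [finsum_eq_single _ 0 fun i hi => by
      obtain ⟨j, rfl⟩ := Nat.exists_eq_succ_of_ne_zero hi
      rw [Nat.succ_eq_add_one, binomSub_zero_succ, zero_smul]]
    simp [binomSub_zero_right]
  · obtain ⟨N, hN⟩ := htr l m n
    obtain ⟨N', hN'⟩ := htr 0 (m + l) n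
    refine ⟨max N N', fun k hk => ?_⟩
    rw [hN k (le_trans (le_max_left _ _) hk), zero_sub, neg_eq_zero]
    refine finsum_eq_zero_of_forall_eq_zero fun i => ?_
    have h := hN' (k + i) (by have := le_max_right N N'; omega)
    push_cast at h
    rw [show m - k + l - i = m + l - (k + i : ℤ) by ring,
      show n + k + i = n + (k + i : ℤ) by ring, h, smul_zero]

/-- The variant of `eq_finsum_binomSub` with truncation in `x`: `(x - y)^l = (-y + x)^l` is expanded
in nonnegative powers of `x`. -/
theorem eq_finsum_binomNegAdd {G : ℤ → ℤ → ℤ → M}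
    (hrec : ∀ l m n, G (l + 1) m n = G l (m + 1) n - G l m (n + 1))
    (htr : ∀ l m n, ∃ N : ℕ, ∀ k : ℕ, N ≤ k → G l (m + k) (n - k) = 0) (l m n : ℤ) :
    G l m n = ∑ᶠ i : ℕ, binomNegAdd l i • G 0 (m + i) (n + l - i) := by
  have h := eq_finsum_binomSub (G := fun l m n => ((-1 : ℂ) ^ l) • G l n m)
    (fun l m n => by
      rw [hrec, zpow_add_one₀ (by norm_num), mul_neg_one, neg_smul, smul_sub, neg_sub])
    (fun l m n => by
      obtain ⟨N, hN⟩ := htr l n m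
      exact ⟨N, fun k hk => by simp only [hN k hk, smul_zero]⟩) l n m
  have h1 : ((-1 : ℂ) ^ l) * (-1) ^ l = 1 := by rw [← mul_zpow]; simp
  have h2 := congrArg (((-1 : ℂ) ^ l) • ·) h
  simp only [smul_smul, h1, one_smul, zpow_zero] at h2
  rw [h2, smul_finsum]
  exact finsum_congr fun i => by rw [smul_smul, binomNegAdd_eq]

/-- A family with the recursion of `(x - y)^l x^m y^n` that is truncated in `x - y` is given by the
expansion of `x^m = (y + (x - y))^m` in nonnegative powers of `x - y`. -/
theorem eq_finsum_choose {G : ℤ → ℤ → ℤ → M}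
    (hrec : ∀ l m n, G (l + 1) m n = G l (m + 1) n - G l m (n + 1))
    (htr : ∀ l m n, ∃ N : ℕ, ∀ k : ℕ, N ≤ k → G (l + k) m (n - k) = 0) (l m n : ℤ) :
    G l m n = ∑ᶠ i : ℕ, ((Ring.choose m i : ℤ) : ℂ) • G (l + i) 0 (m + n - i) := by
  have h := eq_finsum_binomSub (G := fun m n l => ((-1 : ℂ) ^ l) • G l m n)
    (fun m n l => by
      rw [hrec, zpow_add_one₀ (by norm_num), mul_neg_one, neg_smul, smul_sub]
      abel)
    (fun m n l => by
      obtain ⟨N, hN⟩ := htr l m n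
      exact ⟨N, fun k hk => by simp only [hN k hk, smul_zero]⟩) m n l
  have h1 : ((-1 : ℂ) ^ l) * (-1) ^ l = 1 := by rw [← mul_zpow]; simp
  have h2 := congrArg (((-1 : ℂ) ^ l) • ·) h
  simp only [smul_smul, h1, one_smul] at h2
  rw [h2, smul_finsum]
  refine finsum_congr fun i => ?_
  have h3 : (-1 : ℂ) ^ i * (-1) ^ i = 1 := by rw [← mul_pow]; simp
  rw [smul_smul, add_comm n m, binomSub, zpow_add₀ (by norm_num), zpow_natCast]
  congr 1
  linear_combination ((Ring.choose m i : ℤ) : ℂ) * (h1 * (-1 : ℂ) ^ i * (-1) ^ i + h3)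

end Recursion

/-! ### Families of powers acting on functions on a lattice -/

section Families

variable {ι : Type*} [AddCommGroup ι] {M : Type*} [AddCommGroup M]

/-- A function `f` of indices, seen as a formal series, is truncated in the variable whose
multiplication is the shift by `e'`, uniformly in the variable that belongs to `e`. The series can
then be multiplied by integer powers of the difference of the two variables, expanded in nonnegative
powers of the second one. -/
def VanishesAlong (e e' : ι) (f : ι → M) : Prop :=
  ∀ i, ∃ N : ℕ, ∀ k : ℕ, N ≤ k → ∀ a : ℤ, f (i + a • e + (k : ℤ) • e') = 0

theorem VanishesAlong.sub {e e' : ι} {f g : ι → M} (hf : VanishesAlong e e' f)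
    (hg : VanishesAlong e e' g) : VanishesAlong e e' (f - g) := fun i => by
  obtain ⟨N, hN⟩ := hf i
  obtain ⟨N', hN'⟩ := hg i
  exact ⟨max N N', fun k hk a => by
    rw [Pi.sub_apply, hN k (le_trans (le_max_left _ _) hk) a,
      hN' k (le_trans (le_max_right _ _) hk) a, sub_zero]⟩

/-- `G l` behaves as `(x - y)^l` times `G 0`, where `x` and `y` act as the shifts by `e` and
`e'`. -/
def IsPowerFamily (e e' : ι) (G : ℤ → ι → M) : Prop :=
  ∀ l i, G (l + 1) i = G l (i + e) - G l (i + e')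

namespace IsPowerFamily

variable {e e' : ι} {G : ℤ → ι → M}

theorem recursion (hG : IsPowerFamily e e' G) (i : ι) (l m n : ℤ) :
    G (l + 1) (i + m • e + n • e')
      = G l (i + (m + 1) • e + n • e') - G l (i + m • e + (n + 1) • e') := by
  rw [hG]
  congr 2 <;> module

theorem eq_zero_of_le (hG : IsPowerFamily e e' G) {k : ℤ} (hk : G k = 0) {l : ℤ} (hl : k ≤ l) :
    G l = 0 := by
  induction l, hl using Int.leInduction with
  | base => exact hk
  | succ l _ ih => funext i; rw [hG]; simp [ih]

variable [Module ℂ M]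

theorem eq_finsum (hG : IsPowerFamily e e' G) (hv : ∀ l, VanishesAlong e e' (G l)) (l : ℤ)
    (i : ι) :
    G l i = ∑ᶠ k : ℕ, binomSub l k • G 0 (i + (l - k) • e + (k : ℤ) • e') := by
  have h := eq_finsum_binomSub (G := fun l m n => G l (i + m • e + n • e'))
    (fun l m n => hG.recursion i l m n)
    (fun l m n => by
      obtain ⟨N, hN⟩ := hv l (i + m • e + n • e')
      refine ⟨N, fun k hk => ?_⟩
      rw [← hN k hk (-k)]
      congr 1
      module) l 0 0
  simpa using h

theorem eq_finsum' (hG : IsPowerFamily e e' G) (hv : ∀ l, VanishesAlong e' e (G l)) (l : ℤ)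
    (i : ι) :
    G l i = ∑ᶠ k : ℕ, binomNegAdd l k • G 0 (i + (k : ℤ) • e + (l - k) • e') := by
  have h := eq_finsum_binomNegAdd (G := fun l m n => G l (i + m • e + n • e'))
    (fun l m n => hG.recursion i l m n)
    (fun l m n => by
      obtain ⟨N, hN⟩ := hv l (i + m • e + n • e')
      refine ⟨N, fun k hk => ?_⟩
      rw [← hN k hk (-k)]
      congr 1
      module) l 0 0
  simpa using h

theorem eq_zero (hG : IsPowerFamily e e' G)
    (hv : (∀ l, VanishesAlong e e' (G l)) ∨ ∀ l, VanishesAlong e' e (G l)) (h0 : G 0 = 0) (l : ℤ) :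
    G l = 0 := by
  funext i
  rcases hv with hv | hv
  · rw [hG.eq_finsum hv]
    simp [h0]
  · rw [hG.eq_finsum' hv]
    simp [h0]

end IsPowerFamily

/-- The geometric series for `(e - e')⁻¹ f`. -/
noncomputable def geomSeries (e e' : ι) (f : ι → M) : ι → M :=
  fun i => ∑ᶠ k : ℕ, f (i + (-(k : ℤ) - 1) • e + (k : ℤ) • e')

theorem geomSeries_sub {e e' : ι} {f : ι → M} (hf : VanishesAlong e e' f) (i : ι) :
    geomSeries e e' f (i + e) - geomSeries e e' f (i + e') = f i := by
  obtain ⟨N, hN⟩ := hf i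
  have h1 : geomSeries e e' f (i + e)
      = ∑ k ∈ Finset.range (N + 1), f (i + (-(k : ℤ)) • e + (k : ℤ) • e') := by
    rw [geomSeries, finsum_eq_sum_range (N := N + 1) fun k hk => ?_]
    · exact Finset.sum_congr rfl fun k _ => by congr 1; module
    · rw [← hN k (by omega) (-k)]; congr 1; module
  have h2 : geomSeries e e' f (i + e')
      = ∑ k ∈ Finset.range N, f (i + (-((k + 1 : ℕ) : ℤ)) • e + ((k + 1 : ℕ) : ℤ) • e') := by
    rw [geomSeries, finsum_eq_sum_range (N := N) fun k hk => ?_]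
    · exact Finset.sum_congr rfl fun k _ => by congr 1; push_cast; module
    · rw [← hN (k + 1) (by omega) (-(k + 1))]; congr 1; push_cast; module
  rw [h1, h2, Finset.sum_range_succ']
  simp

theorem eq_zero_of_shift_eq {e e' : ι} {f : ι → M} (hf : VanishesAlong e e' f)
    (h : ∀ i, f (i + e) = f (i + e')) : f = 0 := by
  funext i
  have hmove : ∀ k : ℕ, f i = f (i + (-(k : ℤ)) • e + (k : ℤ) • e') := by
    intro k
    induction k with
    | zero => simp
    | succ k ih =>
      rw [ih]
      have h' := h (i + (-((k + 1 : ℕ) : ℤ)) • e + (k : ℤ) • e')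
      refine Eq.trans ?_ (h'.trans ?_) <;> congr 1 <;> push_cast <;> module
  obtain ⟨N, hN⟩ := hf i
  rw [hmove N, hN N le_rfl]
  rfl

theorem exists_uniform_bound {p : ℕ → ℕ → Prop} (hp : ∀ c, ∃ N, ∀ k, N ≤ k → p c k) (R : ℕ) :
    ∃ N, ∀ c < R, ∀ k, N ≤ k → p c k := by
  choose N hN using hp
  exact ⟨∑ c ∈ Finset.range R, N c, fun c hc k hk => hN c k (le_trans
    (Finset.single_le_sum (f := N) (fun _ _ => Nat.zero_le _) (Finset.mem_range.2 hc)) hk)⟩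

/-- The series in three variables with `|y₁| > |y₂| > |y₃|`, as for a product of three fields
applied to a vector: truncated in `y₃` uniformly in `y₁, y₂`, and for each power of `y₃` truncated
in `y₂` uniformly in `y₁`. The variables act as the shifts by `y₁, y₂, y₃`. -/
def iteratedSeries (M : Type*) [AddCommGroup M] [Module ℂ M] (y₁ y₂ y₃ : ι) :
    Submodule ℂ (ι → M) where
  carrier := {f | VanishesAlong y₁ y₂ f ∧ ∀ i, ∃ N : ℕ, ∀ k : ℕ, N ≤ k → ∀ a b : ℤ,
    f (i + a • y₁ + b • y₂ + (k : ℤ) • y₃) = 0}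
  zero_mem' := ⟨fun _ => ⟨0, fun _ _ _ => rfl⟩, fun _ => ⟨0, fun _ _ _ _ => rfl⟩⟩
  add_mem' {f g} hf hg := by
    refine ⟨fun i => ?_, fun i => ?_⟩
    · obtain ⟨N, hN⟩ := hf.1 i
      obtain ⟨N', hN'⟩ := hg.1 i
      exact ⟨max N N', fun k hk a => by
        rw [Pi.add_apply, hN k (le_trans (le_max_left _ _) hk) a,
          hN' k (le_trans (le_max_right _ _) hk) a, add_zero]⟩
    · obtain ⟨N, hN⟩ := hf.2 i
      obtain ⟨N', hN'⟩ := hg.2 i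
      exact ⟨max N N', fun k hk a b => by
        rw [Pi.add_apply, hN k (le_trans (le_max_left _ _) hk) a b,
          hN' k (le_trans (le_max_right _ _) hk) a b, add_zero]⟩
  smul_mem' c f hf := by
    refine ⟨fun i => ?_, fun i => ?_⟩
    · obtain ⟨N, hN⟩ := hf.1 i
      exact ⟨N, fun k hk a => by rw [Pi.smul_apply, hN k hk a, smul_zero]⟩
    · obtain ⟨N, hN⟩ := hf.2 i
      exact ⟨N, fun k hk a b => by rw [Pi.smul_apply, hN k hk a b, smul_zero]⟩

section IteratedSeries

variable [Module ℂ M] {y₁ y₂ y₃ : ι} {f : ι → M}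

theorem vanishesAlong₁₂ (hf : f ∈ iteratedSeries M y₁ y₂ y₃) : VanishesAlong y₁ y₂ f := hf.1

theorem vanishesAlong₁₃ (hf : f ∈ iteratedSeries M y₁ y₂ y₃) : VanishesAlong y₁ y₃ f := fun i => by
  obtain ⟨N, hN⟩ := hf.2 i
  exact ⟨N, fun k hk a => by simpa using hN k hk a 0⟩

theorem vanishesAlong₂₃ (hf : f ∈ iteratedSeries M y₁ y₂ y₃) : VanishesAlong y₂ y₃ f := fun i => by
  obtain ⟨N, hN⟩ := hf.2 i
  exact ⟨N, fun k hk a => by simpa using hN k hk 0 a⟩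

theorem geomSeries₁₂_mem (hf : f ∈ iteratedSeries M y₁ y₂ y₃) :
    geomSeries y₁ y₂ f ∈ iteratedSeries M y₁ y₂ y₃ := by
  refine ⟨fun i => ?_, fun i => ?_⟩
  · obtain ⟨N, hN⟩ := hf.1 i
    refine ⟨N, fun k hk a => finsum_eq_zero_of_forall_eq_zero fun j => ?_⟩
    rw [← hN (k + j) (by omega) (a - j - 1)]
    congr 1
    push_cast
    module
  · obtain ⟨N, hN⟩ := hf.2 i
    refine ⟨N, fun k hk a b => finsum_eq_zero_of_forall_eq_zero fun j => ?_⟩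
    rw [← hN k hk (a - j - 1) (b + j)]
    congr 1
    module

theorem geomSeries₁₃_mem (hf : f ∈ iteratedSeries M y₁ y₂ y₃) :
    geomSeries y₁ y₃ f ∈ iteratedSeries M y₁ y₂ y₃ := by
  refine ⟨fun i => ?_, fun i => ?_⟩
  · obtain ⟨R, hR⟩ := hf.2 i
    obtain ⟨N, hN⟩ := exists_uniform_bound (fun c : ℕ => hf.1 (i + (c : ℤ) • y₃)) R
    refine ⟨N, fun k hk a => finsum_eq_zero_of_forall_eq_zero fun j => ?_⟩
    by_cases hj : j < R
    · rw [← hN j hj k hk (a - j - 1)]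
      congr 1
      module
    · rw [← hR j (by omega) (a - j - 1) k]
      congr 1
      module
  · obtain ⟨N, hN⟩ := hf.2 i
    refine ⟨N, fun k hk a b => finsum_eq_zero_of_forall_eq_zero fun j => ?_⟩
    rw [← hN (k + j) (by omega) (a - j - 1) b]
    congr 1
    push_cast
    module

theorem geomSeries₂₃_mem (hf : f ∈ iteratedSeries M y₁ y₂ y₃) :
    geomSeries y₂ y₃ f ∈ iteratedSeries M y₁ y₂ y₃ := by
  refine ⟨fun i => ?_, fun i => ?_⟩
  · obtain ⟨R, hR⟩ := hf.2 i
    obtain ⟨N, hN⟩ := exists_uniform_bound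
      (fun c : ℕ => hf.1 (i + (-(c : ℤ) - 1) • y₂ + (c : ℤ) • y₃)) R
    refine ⟨N, fun k hk a => finsum_eq_zero_of_forall_eq_zero fun j => ?_⟩
    by_cases hj : j < R
    · rw [← hN j hj k hk a]
      congr 1
      module
    · rw [← hR j (by omega) a (k - j - 1)]
      congr 1
      module
  · obtain ⟨N, hN⟩ := hf.2 i
    refine ⟨N, fun k hk a b => finsum_eq_zero_of_forall_eq_zero fun j => ?_⟩
    rw [← hN (k + j) (by omega) a (b - j - 1)]
    congr 1
    push_cast
    module

/-- Multiplication by a variable, that is the shift by `e`, on iterated series. -/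
def iteratedShift (M : Type*) [AddCommGroup M] [Module ℂ M] (y₁ y₂ y₃ e : ι) :
    Module.End ℂ (iteratedSeries M y₁ y₂ y₃) where
  toFun f := ⟨fun i => f.1 (i + e), by
    refine ⟨fun i => ?_, fun i => ?_⟩
    · obtain ⟨N, hN⟩ := f.2.1 (i + e)
      exact ⟨N, fun k hk a => (congrArg f.1 (by abel)).trans (hN k hk a)⟩
    · obtain ⟨N, hN⟩ := f.2.2 (i + e)
      exact ⟨N, fun k hk a b => (congrArg f.1 (by abel)).trans (hN k hk a b)⟩⟩
  map_add' _ _ := rfl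
  map_smul' _ _ := rfl

theorem commute_shift_sub (a b c d : ι) :
    Commute (iteratedShift M y₁ y₂ y₃ a - iteratedShift M y₁ y₂ y₃ b)
      (iteratedShift M y₁ y₂ y₃ c - iteratedShift M y₁ y₂ y₃ d) := by
  refine LinearMap.ext fun f => Subtype.ext (funext fun i => ?_)
  change f.1 (i + a + c) - f.1 (i + a + d) - (f.1 (i + b + c) - f.1 (i + b + d))
    = f.1 (i + c + a) - f.1 (i + c + b) - (f.1 (i + d + a) - f.1 (i + d + b))
  simp only [add_right_comm i]
  abel

theorem units_mul_apply {x : (Module.End ℂ (iteratedSeries M y₁ y₂ y₃))ˣ} {a b : ι}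
    (hx : (x : Module.End ℂ (iteratedSeries M y₁ y₂ y₃))
      = iteratedShift M y₁ y₂ y₃ a - iteratedShift M y₁ y₂ y₃ b)
    (r : (Module.End ℂ (iteratedSeries M y₁ y₂ y₃))ˣ) (g : iteratedSeries M y₁ y₂ y₃) (i : ι) :
    ((x * r).1 g).1 i = (r.1 g).1 (i + a) - (r.1 g).1 (i + b) := by
  rw [Units.val_mul, Module.End.mul_apply, hx]
  rfl

theorem isUnit_shift_sub {e e' : ι}
    (hv : ∀ f ∈ iteratedSeries M y₁ y₂ y₃, VanishesAlong e e' f)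
    (hmem : ∀ f ∈ iteratedSeries M y₁ y₂ y₃, geomSeries e e' f ∈ iteratedSeries M y₁ y₂ y₃) :
    IsUnit (iteratedShift M y₁ y₂ y₃ e - iteratedShift M y₁ y₂ y₃ e') := by
  rw [Module.End.isUnit_iff]
  refine ⟨(injective_iff_map_eq_zero _).2 fun f hf => Subtype.ext ?_, fun f => ?_⟩
  · exact eq_zero_of_shift_eq (hv f.1 f.2) fun i =>
      sub_eq_zero.1 (congrFun (congrArg Subtype.val hf) i)
  · exact ⟨⟨_, hmem f.1 f.2⟩, Subtype.ext (funext fun i => geomSeries_sub (hv f.1 f.2) i)⟩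

theorem isUnit₁₂ : IsUnit (iteratedShift M y₁ y₂ y₃ y₁ - iteratedShift M y₁ y₂ y₃ y₂) :=
  isUnit_shift_sub (fun _ => vanishesAlong₁₂) fun _ => geomSeries₁₂_mem

theorem isUnit₁₃ : IsUnit (iteratedShift M y₁ y₂ y₃ y₁ - iteratedShift M y₁ y₂ y₃ y₃) :=
  isUnit_shift_sub (fun _ => vanishesAlong₁₃) fun _ => geomSeries₁₃_mem

theorem isUnit₂₃ : IsUnit (iteratedShift M y₁ y₂ y₃ y₂ - iteratedShift M y₁ y₂ y₃ y₃) :=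
  isUnit_shift_sub (fun _ => vanishesAlong₂₃) fun _ => geomSeries₂₃_mem

end IteratedSeries

/-- `P l m n` behaves as `(x₁ - x₂)^l (x₁ - x₃)^m (x₂ - x₃)^n` times `P 0 0 0`, where `x₁, x₂, x₃`
act as the shifts by `e₁, e₂, e₃`. -/
structure IsTripleFamily (e₁ e₂ e₃ : ι) (P : ℤ → ℤ → ℤ → ι → M) : Prop where
  family₁₂ : ∀ m n, IsPowerFamily e₁ e₂ fun l => P l m n
  family₁₃ : ∀ l n, IsPowerFamily e₁ e₃ fun m => P l m n
  family₂₃ : ∀ l m, IsPowerFamily e₂ e₃ fun n => P l m n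

namespace IsTripleFamily

variable {e₁ e₂ e₃ : ι} {P Q : ℤ → ℤ → ℤ → ι → M}

theorem sub (hP : IsTripleFamily e₁ e₂ e₃ P) (hQ : IsTripleFamily e₁ e₂ e₃ Q) :
    IsTripleFamily e₁ e₂ e₃ (P - Q) where
  family₁₂ m n l i := by
    have h := hP.family₁₂ m n l i
    have h' := hQ.family₁₂ m n l i
    simp only [Pi.sub_apply] at h h' ⊢
    rw [h, h']
    abel
  family₁₃ l n m i := by
    have h := hP.family₁₃ l n m i
    have h' := hQ.family₁₃ l n m i
    simp only [Pi.sub_apply] at h h' ⊢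
    rw [h, h']
    abel
  family₂₃ l m n i := by
    have h := hP.family₂₃ l m n i
    have h' := hQ.family₂₃ l m n i
    simp only [Pi.sub_apply] at h h' ⊢
    rw [h, h']
    abel

/-- `x₁ - x₂ = (x₁ - x₃) - (x₂ - x₃)`. -/
theorem recursion (hP : IsTripleFamily e₁ e₂ e₃ P) (l m n : ℤ) (i : ι) :
    P (l + 1) m n i = P l (m + 1) n i - P l m (n + 1) i := by
  have h1 := hP.family₁₂ m n l i
  have h2 := hP.family₁₃ l n m i
  have h3 := hP.family₂₃ l m n i
  simp only at h1 h2 h3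
  rw [h1, h2, h3]
  abel

end IsTripleFamily

theorem exists_isTripleFamily [Module ℂ M] {y₁ y₂ y₃ e₁ e₂ e₃ : ι}
    (h₁₂ : IsUnit (iteratedShift M y₁ y₂ y₃ e₁ - iteratedShift M y₁ y₂ y₃ e₂))
    (h₁₃ : IsUnit (iteratedShift M y₁ y₂ y₃ e₁ - iteratedShift M y₁ y₂ y₃ e₃))
    (h₂₃ : IsUnit (iteratedShift M y₁ y₂ y₃ e₂ - iteratedShift M y₁ y₂ y₃ e₃))
    {f : ι → M} (hf : f ∈ iteratedSeries M y₁ y₂ y₃) :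
    ∃ P : ℤ → ℤ → ℤ → ι → M, IsTripleFamily e₁ e₂ e₃ P ∧ P 0 0 0 = f ∧
      ∀ l m n, P l m n ∈ iteratedSeries M y₁ y₂ y₃ := by
  obtain ⟨u, hu⟩ := h₁₂
  obtain ⟨v, hv⟩ := h₁₃
  obtain ⟨w, hw⟩ := h₂₃
  have huv : Commute v u := by
    rw [← Commute.units_val_iff, hu, hv]
    exact commute_shift_sub _ _ _ _
  have huw : Commute w u := by
    rw [← Commute.units_val_iff, hu, hw]
    exact commute_shift_sub _ _ _ _
  have hvw : Commute w v := by
    rw [← Commute.units_val_iff, hv, hw]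
    exact commute_shift_sub _ _ _ _
  refine ⟨fun l m n => ((u ^ l * v ^ m * w ^ n).1 ⟨f, hf⟩).1, ⟨?_, ?_, ?_⟩, ?_, ?_⟩
  · intro m n l i
    beta_reduce
    rw [← units_mul_apply hu, add_comm l 1, zpow_one_add, mul_assoc, mul_assoc, mul_assoc]
  · intro l n m i
    beta_reduce
    rw [← units_mul_apply hv, add_comm m 1, zpow_one_add, ← mul_assoc, ← mul_assoc, ← mul_assoc,
      (huv.zpow_right l).eq]
  · intro l m n i
    beta_reduce
    rw [← units_mul_apply hw, add_comm n 1, zpow_one_add, ← mul_assoc, ← mul_assoc, ← mul_assoc,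
      (huw.zpow_right l).eq, mul_assoc (u ^ l) w, (hvw.zpow_right m).eq, ← mul_assoc]
  · simp
  · exact fun l m n => ((u ^ l * v ^ m * w ^ n).1 ⟨f, hf⟩).2

end Families

namespace IsTripleFamily

variable {ι : Type*} [AddCommGroup ι] {M : Type*} [AddCommGroup M] [Module ℂ M]
  {e₁ e₂ e₃ : ι} {D : ℤ → ℤ → ℤ → ι → M}

theorem eq_zero_of₁₂ (hD : IsTripleFamily e₁ e₂ e₃ D) {l : ℤ} (h0 : D l 0 0 = 0)
    (h₁₃ : (∀ m n, VanishesAlong e₁ e₃ (D l m n)) ∨ ∀ m n, VanishesAlong e₃ e₁ (D l m n))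
    (h₂₃ : (∀ m n, VanishesAlong e₂ e₃ (D l m n)) ∨ ∀ m n, VanishesAlong e₃ e₂ (D l m n))
    (m n : ℤ) : D l m n = 0 :=
  (hD.family₂₃ l m).eq_zero (h₂₃.imp (fun h => h m) fun h => h m)
    ((hD.family₁₃ l 0).eq_zero (h₁₃.imp (fun h m => h m 0) fun h m => h m 0) h0 m) n

theorem eq_zero_of₁₃ (hD : IsTripleFamily e₁ e₂ e₃ D) {m : ℤ} (h0 : D 0 m 0 = 0)
    (h₁₂ : (∀ l n, VanishesAlong e₁ e₂ (D l m n)) ∨ ∀ l n, VanishesAlong e₂ e₁ (D l m n))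
    (h₂₃ : (∀ l n, VanishesAlong e₂ e₃ (D l m n)) ∨ ∀ l n, VanishesAlong e₃ e₂ (D l m n))
    (l n : ℤ) : D l m n = 0 :=
  (hD.family₂₃ l m).eq_zero (h₂₃.imp (fun h => h l) fun h => h l)
    ((hD.family₁₂ m 0).eq_zero (h₁₂.imp (fun h l => h l 0) fun h l => h l 0) h0 l) n

theorem eq_zero_of₂₃ (hD : IsTripleFamily e₁ e₂ e₃ D) {n : ℤ} (h0 : D 0 0 n = 0)
    (h₁₂ : (∀ l m, VanishesAlong e₁ e₂ (D l m n)) ∨ ∀ l m, VanishesAlong e₂ e₁ (D l m n))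
    (h₁₃ : (∀ l m, VanishesAlong e₁ e₃ (D l m n)) ∨ ∀ l m, VanishesAlong e₃ e₁ (D l m n))
    (l m : ℤ) : D l m n = 0 :=
  (hD.family₁₃ l n).eq_zero (h₁₃.imp (fun h => h l) fun h => h l)
    ((hD.family₁₂ 0 n).eq_zero (h₁₂.imp (fun h l => h l 0) fun h l => h l 0) h0 l) m

end IsTripleFamily

/-! ### The three operators in their six orders -/

namespace VOAModule

variable {V : Type*} [AddCommGroup V] [Module ℂ V] {𝒱 : VertexOperatorAlgebra V}
  {M₁ M₂ : Type*} [AddCommGroup M₁] [Module ℂ M₁] [AddCommGroup M₂] [Module ℂ M₂]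

theorem leftAction_apply (W₂ : VOAModule 𝒱 M₂) (a : V) (m : ℤ) (Φ : truncSeries M₁ M₂) (α : ℂ)
    (u : M₁) :
    W₂.leftAction a m Φ α u = ∑ᶠ i : ℕ, binomSub m i • W₂.Y a (m - i) (Φ.1 (α + i) u) := rfl

theorem rightAction_apply (W₁ : VOAModule 𝒱 M₁) (a : V) (m : ℤ) (Φ : truncSeries M₁ M₂) (α : ℂ)
    (u : M₁) :
    W₁.rightAction a m Φ α u
      = ∑ᶠ i : ℕ, binomNegAdd m i • Φ.1 (α + m - i) (W₁.Y a i u) := rfl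

theorem circ_apply (W₁ : VOAModule 𝒱 M₁) (W₂ : VOAModule 𝒱 M₂) (a : V) (m : ℤ)
    (Φ : truncSeries M₁ M₂) (α : ℂ) (u : M₁) :
    (W₁.circ W₂ a m Φ).1 α u = W₂.leftAction a m Φ α u - W₁.rightAction a m Φ α u := rfl

theorem eventually_Y_eq_zero (W : VOAModule 𝒱 M₁) (a : V) (u : M₁) (s : ℤ) :
    ∃ N : ℕ, ∀ k : ℕ, N ≤ k → W.Y a (s + k) u = 0 := by
  obtain ⟨N, hN⟩ := W.isWeakModule.truncated a u
  exact ⟨(N - s).toNat, fun k hk => hN _ (by omega)⟩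

theorem eventually_coeff_eq_zero (Φ : truncSeries M₁ M₂) (α : ℂ) (u : M₁) :
    ∃ N : ℕ, ∀ k : ℕ, N ≤ k → Φ.1 (α + k) u = 0 := by
  obtain ⟨N, hN⟩ := Φ.2 α u
  exact ⟨N.toNat, fun k hk => by simpa using hN k (by omega)⟩

theorem finite_support_leftAction (W₂ : VOAModule 𝒱 M₂) (a : V) (m : ℤ) (Φ : truncSeries M₁ M₂)
    (α : ℂ) (u : M₁) :
    (Function.support fun i : ℕ => binomSub m i • W₂.Y a (m - i) (Φ.1 (α + i) u)).Finite := by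
  obtain ⟨N, hN⟩ := eventually_coeff_eq_zero Φ α u
  exact finite_support_of_eventually_zero (N := N) fun i hi => by simp [hN i (by omega)]

theorem finite_support_rightAction (W₁ : VOAModule 𝒱 M₁) (a : V) (m : ℤ)
    (Φ : truncSeries M₁ M₂) (α : ℂ) (u : M₁) :
    (Function.support fun i : ℕ =>
      binomNegAdd m i • Φ.1 (α + m - i) (W₁.Y a i u)).Finite := by
  obtain ⟨N, hN⟩ := W₁.isWeakModule.truncated a u
  exact finite_support_of_eventually_zero (N := N) fun i hi => by simp [hN i hi]

section PowerFamily

variable {ι : Type*} [AddCommGroup ι] {e e' : ι} {j : ℤ → ℂ → ι}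

/-- `(x - z)^p` times a series `∑ Y_{W₂}(a, x) Ψ(z)`, truncated in `z`, has residue `leftAction`.
The map `ev` stands for a further operator that is applied on the left. -/
theorem eq_leftAction {M : Type*} [AddCommGroup M] [Module ℂ M] {G : ℤ → ι → M}
    (hG : IsPowerFamily e e' G) (hv : ∀ l, VanishesAlong e e' (G l))
    (hj : ∀ s α (k r : ℤ), j s α + k • e + r • e' = j (s + k) (α + r))
    (W₂ : VOAModule 𝒱 M₂) (a : V) (Ψ : truncSeries M₁ M₂) (u : M₁) (ev : M₂ →ₗ[ℂ] M)
    (h0 : ∀ s α, G 0 (j s α) = ev (W₂.Y a s (Ψ.1 α u))) (p : ℤ) (α : ℂ) :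
    G p (j 0 α) = ev (W₂.leftAction a p Ψ α u) := by
  rw [hG.eq_finsum hv, leftAction_apply, map_finsum ev (finite_support_leftAction W₂ a p Ψ α u)]
  refine finsum_congr fun k => ?_
  rw [hj, h0, map_smul, zero_add, Int.cast_natCast]

/-- `(-z + x)^p` times a series `∑ Ψ(z) Y_{W₁}(a, x)`, truncated in `x`, has residue
`rightAction`. -/
theorem eq_rightAction {M : Type*} [AddCommGroup M] [Module ℂ M] {G : ℤ → ι → M}
    (hG : IsPowerFamily e e' G) (hv : ∀ l, VanishesAlong e' e (G l))
    (hj : ∀ s α (k r : ℤ), j s α + k • e + r • e' = j (s + k) (α + r))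
    (W₁ : VOAModule 𝒱 M₁) (a : V) (Ψ : truncSeries M₁ M₂) (u : M₁) (ev : M₂ →ₗ[ℂ] M)
    (h0 : ∀ s α, G 0 (j s α) = ev (Ψ.1 α (W₁.Y a s u))) (p : ℤ) (α : ℂ) :
    G p (j 0 α) = ev (W₁.rightAction a p Ψ α u) := by
  rw [hG.eq_finsum' hv, rightAction_apply,
    map_finsum ev (finite_support_rightAction W₁ a p Ψ α u)]
  refine finsum_congr fun k => ?_
  rw [hj, h0, map_smul, zero_add, Int.cast_sub, Int.cast_natCast, add_sub_assoc]

/-- A power family built on a series in two variables agrees with `mulSub`. -/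
theorem eq_mulSub_pow {M : Type*} [AddCommGroup M] [Module ℂ M] {G : ℤ → ι → M}
    (hG : IsPowerFamily e e' G)
    (hj : ∀ s α (k r : ℤ), j s α + k • e + r • e' = j (s + k) (α + r))
    (ev : (M₁ →ₗ[ℂ] M₂) →ₗ[ℂ] M) (h : ℤ → ℂ → M₁ →ₗ[ℂ] M₂)
    (h0 : ∀ s α, G 0 (j s α) = ev (h s α)) (k : ℕ) (s : ℤ) (α : ℂ) :
    G k (j s α) = ev ((mulSub M₁ M₂ ^ k) h s α) := by
  induction k generalizing s α with
  | zero => exact h0 s α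
  | succ k ih =>
    have h1 := hj s α 1 0
    have h2 := hj s α 0 1
    simp only [one_smul, zero_smul, add_zero, Int.cast_zero, Int.cast_one] at h1 h2
    rw [Nat.cast_succ, hG, h1, h2, ih, ih, pow_succ', Module.End.mul_apply]
    exact (map_sub ev _ _).symm

end PowerFamily

/-- The indices of a series in three variables `x₁, x₂, z`: two fields with integral powers and a
series with complex powers. -/
abbrev TripleIndex := ℤ × ℤ × ℂ

/-- The shift of indices that belongs to multiplication by `x₁`. -/
abbrev e₁ : TripleIndex := (1, 0, 0)

/-- The shift of indices that belongs to multiplication by `x₂`. -/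
abbrev e₂ : TripleIndex := (0, 1, 0)

/-- The shift of indices that belongs to multiplication by `z`. -/
abbrev e₃ : TripleIndex := (0, 0, 1)

theorem index₁₃ (t s : ℤ) (α : ℂ) (k r : ℤ) :
    ((s, t, α) : TripleIndex) + k • e₁ + r • e₃ = (s + k, t, α + r) := by
  simp

theorem index₂₃ (s t : ℤ) (α : ℂ) (k r : ℤ) :
    ((s, t, α) : TripleIndex) + k • e₂ + r • e₃ = (s, t + k, α + r) := by
  simp

theorem index₁₂ (s t : ℤ) (α : ℂ) (k r : ℤ) :
    ((s, t, α) : TripleIndex) + k • e₁ + r • e₂ = (s + k, t + r, α) := by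
  simp

section Products

variable (W₁ : VOAModule 𝒱 M₁) (W₂ : VOAModule 𝒱 M₂) (a b : V) (Φ : truncSeries M₁ M₂) (u : M₁)

theorem mem_leftLeft :
    (fun i : TripleIndex => W₂.Y a i.1 (W₂.Y b i.2.1 (Φ.1 i.2.2 u)))
      ∈ iteratedSeries M₂ e₁ e₂ e₃ := by
  refine ⟨fun ⟨s, t, α⟩ => ?_, fun ⟨s, t, α⟩ => ?_⟩
  · obtain ⟨N, hN⟩ := W₂.eventually_Y_eq_zero b (Φ.1 α u) t
    exact ⟨N, fun k hk c => by simp [hN k hk]⟩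
  · obtain ⟨N, hN⟩ := eventually_coeff_eq_zero Φ α u
    exact ⟨N, fun k hk c d => by simp [hN k hk]⟩

theorem mem_leftLeft_swap :
    (fun i : TripleIndex => W₂.Y b i.2.1 (W₂.Y a i.1 (Φ.1 i.2.2 u)))
      ∈ iteratedSeries M₂ e₂ e₁ e₃ := by
  refine ⟨fun ⟨s, t, α⟩ => ?_, fun ⟨s, t, α⟩ => ?_⟩
  · obtain ⟨N, hN⟩ := W₂.eventually_Y_eq_zero a (Φ.1 α u) s
    exact ⟨N, fun k hk c => by simp [hN k hk]⟩
  · obtain ⟨N, hN⟩ := eventually_coeff_eq_zero Φ α u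
    exact ⟨N, fun k hk c d => by simp [hN k hk]⟩

theorem mem_leftRight :
    (fun i : TripleIndex => W₂.Y a i.1 (Φ.1 i.2.2 (W₁.Y b i.2.1 u)))
      ∈ iteratedSeries M₂ e₁ e₃ e₂ := by
  refine ⟨fun ⟨s, t, α⟩ => ?_, fun ⟨s, t, α⟩ => ?_⟩
  · obtain ⟨N, hN⟩ := eventually_coeff_eq_zero Φ α (W₁.Y b t u)
    exact ⟨N, fun k hk c => by simp [hN k hk]⟩
  · obtain ⟨N, hN⟩ := W₁.eventually_Y_eq_zero b u t
    exact ⟨N, fun k hk c d => by simp [hN k hk]⟩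

theorem mem_leftRight_swap :
    (fun i : TripleIndex => W₂.Y b i.2.1 (Φ.1 i.2.2 (W₁.Y a i.1 u)))
      ∈ iteratedSeries M₂ e₂ e₃ e₁ := by
  refine ⟨fun ⟨s, t, α⟩ => ?_, fun ⟨s, t, α⟩ => ?_⟩
  · obtain ⟨N, hN⟩ := eventually_coeff_eq_zero Φ α (W₁.Y a s u)
    exact ⟨N, fun k hk c => by simp [hN k hk]⟩
  · obtain ⟨N, hN⟩ := W₁.eventually_Y_eq_zero a u s
    exact ⟨N, fun k hk c d => by simp [hN k hk]⟩

theorem mem_rightRight :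
    (fun i : TripleIndex => Φ.1 i.2.2 (W₁.Y a i.1 (W₁.Y b i.2.1 u)))
      ∈ iteratedSeries M₂ e₃ e₁ e₂ := by
  refine ⟨fun ⟨s, t, α⟩ => ?_, fun ⟨s, t, α⟩ => ?_⟩
  · obtain ⟨N, hN⟩ := W₁.eventually_Y_eq_zero a (W₁.Y b t u) s
    exact ⟨N, fun k hk c => by simp [hN k hk]⟩
  · obtain ⟨N, hN⟩ := W₁.eventually_Y_eq_zero b u t
    exact ⟨N, fun k hk c d => by simp [hN k hk]⟩

theorem mem_rightRight_swap :
    (fun i : TripleIndex => Φ.1 i.2.2 (W₁.Y b i.2.1 (W₁.Y a i.1 u)))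
      ∈ iteratedSeries M₂ e₃ e₂ e₁ := by
  refine ⟨fun ⟨s, t, α⟩ => ?_, fun ⟨s, t, α⟩ => ?_⟩
  · obtain ⟨N, hN⟩ := W₁.eventually_Y_eq_zero b (W₁.Y a s u) t
    exact ⟨N, fun k hk c => by simp [hN k hk]⟩
  · obtain ⟨N, hN⟩ := W₁.eventually_Y_eq_zero a u s
    exact ⟨N, fun k hk c d => by simp [hN k hk]⟩

end Products

/-! ### Double commutators -/

/-- `S l m n` and `T l m n` stand for `(x₁ - x₂)^l (x₁ - z)^m (x₂ - z)^n` times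
`[Y(a, x₁), [Y(b, x₂), Φ(z)]] u` and `[Y(b, x₂), [Y(a, x₁), Φ(z)]] u`, where each of the
products of the three operators is multiplied by the expansion that belongs to its order. The fields
record the residues that enter the Jacobi identity and the commutator that enters locality; the
residue in `x₁` or `x₂` is the coefficient of index `0`. -/
structure IsCommutatorPair (W₁ : VOAModule 𝒱 M₁) (W₂ : VOAModule 𝒱 M₂) (a b : V)
    (Φ : truncSeries M₁ M₂) (u : M₁) (S T : ℤ → ℤ → ℤ → TripleIndex → M₂) : Prop where
  familyS : IsTripleFamily e₁ e₂ e₃ S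
  familyT : IsTripleFamily e₁ e₂ e₃ T
  S_circ : ∀ p q α, S 0 p q (0, 0, α) = (W₁.circ W₂ a p (W₁.circ W₂ b q Φ)).1 α u
  T_circ : ∀ p q α, T 0 p q (0, 0, α) = (W₁.circ W₂ b q (W₁.circ W₂ a p Φ)).1 α u
  S_commutator : ∀ q s α, S 0 0 q (s, 0, α)
    = W₂.Y a s ((W₁.circ W₂ b q Φ).1 α u) - (W₁.circ W₂ b q Φ).1 α (W₁.Y a s u)
  S_sub_T : ∀ l n α,
    S l 0 n (0, 0, α) - T l 0 n (0, 0, α) = (W₁.circ W₂ (𝒱.Y a l b) n Φ).1 α u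

theorem mulSub_pow_sub_eq_zero {W₁ : VOAModule 𝒱 M₁} {W₂ : VOAModule 𝒱 M₂} {Φ : HomSeries M₁ M₂}
    {a : V} {k : ℕ}
    (h : (mulSub M₁ M₂ ^ k) (fun m α => W₂.Y a m ∘ₗ Φ α)
      = (mulSub M₁ M₂ ^ k) (fun m α => Φ α ∘ₗ W₁.Y a m)) :
    (mulSub M₁ M₂ ^ k) (fun m α => W₂.Y a m ∘ₗ Φ α - Φ α ∘ₗ W₁.Y a m) = 0 := by
  rw [← sub_eq_zero, ← map_sub] at h
  exact h

theorem isUnit_sub_swap {ι M : Type*} [AddCommGroup ι] [AddCommGroup M] [Module ℂ M]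
    {y₁ y₂ y₃ e e' : ι}
    (h : IsUnit (iteratedShift M y₁ y₂ y₃ e - iteratedShift M y₁ y₂ y₃ e')) :
    IsUnit (iteratedShift M y₁ y₂ y₃ e' - iteratedShift M y₁ y₂ y₃ e) := by
  have hneg : ⇑(iteratedShift M y₁ y₂ y₃ e' - iteratedShift M y₁ y₂ y₃ e)
      = Neg.neg ∘ ⇑(iteratedShift M y₁ y₂ y₃ e - iteratedShift M y₁ y₂ y₃ e') :=
    funext fun f => (neg_sub _ _).symm
  rw [Module.End.isUnit_iff] at h ⊢
  rw [hneg]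
  exact (Equiv.neg _).bijective.comp h

/-- The two products `Y(a, x₁) Y(b, x₂)` and `Y(b, x₂) Y(a, x₁)` on a module agree after
multiplication by a high power of `x₁ - x₂`. -/
theorem finsum_binom_eq_of_large (W : VOAModule 𝒱 M₁) {a b : V} {L : ℤ}
    (hL : ∀ l, L ≤ l → 𝒱.Y a l b = 0) {l : ℤ} (hl : L ≤ l) (s t : ℤ) (w : M₁) :
    ∑ᶠ i : ℕ, binomSub l i • W.Y a (s + l - i) (W.Y b (t + i) w)
      = ∑ᶠ i : ℕ, binomNegAdd l i • W.Y b (t + l - i) (W.Y a (s + i) w) := by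
  rw [← sub_eq_zero, W.isWeakModule.jacobi a b w l s t]
  exact finsum_eq_zero_of_forall_eq_zero fun i => by
    rw [hL _ (by omega), map_zero]
    simp

/-- The iterate formula on a module. -/
theorem finsum_binom_sub_eq_Y (W : VOAModule 𝒱 M₁) (a b : V) (l t : ℤ) (w : M₁) :
    ∑ᶠ i : ℕ, binomSub l i • W.Y a (l - i) (W.Y b (t + i) w)
      - ∑ᶠ i : ℕ, binomNegAdd l i • W.Y b (t + l - i) (W.Y a i w) = W.Y (𝒱.Y a l b) t w := by
  have h := W.isWeakModule.jacobi a b w l 0 t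
  simp only [zero_add] at h
  rw [h, finsum_eq_single _ 0 fun i hi => by
    rw [Ring.choose_zero_pos ℤ (Nat.pos_of_ne_zero hi), Int.cast_zero, zero_smul]]
  simp

/-- For a local series the double commutators exist, and the one that contains `[Y(b, x₂), Φ(z)]`
is annihilated by a power of `x₂ - z`, the one that contains `[Y(a, x₁), Φ(z)]` by a power of
`x₁ - z`, and their difference, which contains `[Y(a, x₁), Y(b, x₂)]`, by a power of `x₁ - x₂`. The
exponents do not depend on the vector. -/
theorem exists_isCommutatorPair (W₁ : VOAModule 𝒱 M₁) (W₂ : VOAModule 𝒱 M₂) (a b : V)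
    {Φ : truncSeries M₁ M₂} (hΦ : IsLocal W₁ W₂ Φ.1) :
    ∃ k₁₂ k₁₃ k₂₃ : ℤ, ∀ u : M₁, ∃ S T : ℤ → ℤ → ℤ → TripleIndex → M₂,
      IsCommutatorPair W₁ W₂ a b Φ u S T ∧ (∀ l m n : ℤ, k₂₃ ≤ n → S l m n = 0) ∧
      (∀ l m n : ℤ, k₁₃ ≤ m → T l m n = 0) ∧ ∀ l m n : ℤ, k₁₂ ≤ l → S l m n = T l m n := by
  obtain ⟨L, hL⟩ := 𝒱.truncated a b
  obtain ⟨ka, -, hka⟩ := hΦ a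
  obtain ⟨kb, -, hkb⟩ := hΦ b
  refine ⟨L, ka, kb, fun u => ?_⟩
  -- the families of the orders `abΦ`, `baΦ`, `aΦb`, `bΦa`, `Φab`, `Φba`; all six are families for
  -- the same three differences, expanded according to the order
  obtain ⟨P₁, f₁, z₁, m₁⟩ := exists_isTripleFamily (e₁ := e₁) (e₂ := e₂) (e₃ := e₃)
    isUnit₁₂ isUnit₁₃ isUnit₂₃ (mem_leftLeft W₂ a b Φ u)
  obtain ⟨P₂, f₂, z₂, m₂⟩ := exists_isTripleFamily (e₁ := e₁) (e₂ := e₂) (e₃ := e₃)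
    (isUnit_sub_swap isUnit₁₂) isUnit₂₃ isUnit₁₃ (mem_leftLeft_swap W₂ a b Φ u)
  obtain ⟨P₃, f₃, z₃, m₃⟩ := exists_isTripleFamily (e₁ := e₁) (e₂ := e₂) (e₃ := e₃)
    isUnit₁₃ isUnit₁₂ (isUnit_sub_swap isUnit₂₃) (mem_leftRight W₁ W₂ a b Φ u)
  obtain ⟨P₄, f₄, z₄, m₄⟩ := exists_isTripleFamily (e₁ := e₁) (e₂ := e₂) (e₃ := e₃)
    (isUnit_sub_swap isUnit₁₃) (isUnit_sub_swap isUnit₂₃) isUnit₁₂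
    (mem_leftRight_swap W₁ W₂ a b Φ u)
  obtain ⟨P₅, f₅, z₅, m₅⟩ := exists_isTripleFamily (e₁ := e₁) (e₂ := e₂) (e₃ := e₃)
    isUnit₂₃ (isUnit_sub_swap isUnit₁₂) (isUnit_sub_swap isUnit₁₃) (mem_rightRight W₁ a b Φ u)
  obtain ⟨P₆, f₆, z₆, m₆⟩ := exists_isTripleFamily (e₁ := e₁) (e₂ := e₂) (e₃ := e₃)
    (isUnit_sub_swap isUnit₂₃) (isUnit_sub_swap isUnit₁₃) (isUnit_sub_swap isUnit₁₂)
    (mem_rightRight_swap W₁ a b Φ u)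
  -- the pairs of orders that differ by one transposition
  have g₁₂ := f₁.sub f₂
  have g₅₆ := f₅.sub f₆
  have g₁₃ := f₁.sub f₃
  have g₄₆ := f₄.sub f₆
  have g₂₄ := f₂.sub f₄
  have g₃₅ := f₃.sub f₅
  -- for such a pair, the two differences of variables that are not affected by the transposition
  -- are expanded in the same direction
  have v₁₂_₂₃ : ∀ l m n, VanishesAlong e₂ e₃ ((P₁ - P₂) l m n) := fun l m n =>
    (vanishesAlong₂₃ (m₁ l m n)).sub (vanishesAlong₁₃ (m₂ l m n))
  have v₁₂_₁₃ : ∀ l m n, VanishesAlong e₁ e₃ ((P₁ - P₂) l m n) := fun l m n =>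
    (vanishesAlong₁₃ (m₁ l m n)).sub (vanishesAlong₂₃ (m₂ l m n))
  have v₅₆_₃₂ : ∀ l m n, VanishesAlong e₃ e₂ ((P₅ - P₆) l m n) := fun l m n =>
    (vanishesAlong₁₃ (m₅ l m n)).sub (vanishesAlong₁₂ (m₆ l m n))
  have v₅₆_₃₁ : ∀ l m n, VanishesAlong e₃ e₁ ((P₅ - P₆) l m n) := fun l m n =>
    (vanishesAlong₁₂ (m₅ l m n)).sub (vanishesAlong₁₃ (m₆ l m n))
  have v₁₃_₁₂ : ∀ l m n, VanishesAlong e₁ e₂ ((P₁ - P₃) l m n) := fun l m n =>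
    (vanishesAlong₁₂ (m₁ l m n)).sub (vanishesAlong₁₃ (m₃ l m n))
  have v₁₃_₁₃ : ∀ l m n, VanishesAlong e₁ e₃ ((P₁ - P₃) l m n) := fun l m n =>
    (vanishesAlong₁₃ (m₁ l m n)).sub (vanishesAlong₁₂ (m₃ l m n))
  have v₄₆_₂₁ : ∀ l m n, VanishesAlong e₂ e₁ ((P₄ - P₆) l m n) := fun l m n =>
    (vanishesAlong₁₃ (m₄ l m n)).sub (vanishesAlong₂₃ (m₆ l m n))
  have v₄₆_₃₁ : ∀ l m n, VanishesAlong e₃ e₁ ((P₄ - P₆) l m n) := fun l m n =>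
    (vanishesAlong₂₃ (m₄ l m n)).sub (vanishesAlong₁₃ (m₆ l m n))
  have v₂₄_₂₁ : ∀ l m n, VanishesAlong e₂ e₁ ((P₂ - P₄) l m n) := fun l m n =>
    (vanishesAlong₁₂ (m₂ l m n)).sub (vanishesAlong₁₃ (m₄ l m n))
  have v₂₄_₂₃ : ∀ l m n, VanishesAlong e₂ e₃ ((P₂ - P₄) l m n) := fun l m n =>
    (vanishesAlong₁₃ (m₂ l m n)).sub (vanishesAlong₁₂ (m₄ l m n))
  have v₃₅_₁₂ : ∀ l m n, VanishesAlong e₁ e₂ ((P₃ - P₅) l m n) := fun l m n =>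
    (vanishesAlong₁₃ (m₃ l m n)).sub (vanishesAlong₂₃ (m₅ l m n))
  have v₃₅_₃₂ : ∀ l m n, VanishesAlong e₃ e₂ ((P₃ - P₅) l m n) := fun l m n =>
    (vanishesAlong₂₃ (m₃ l m n)).sub (vanishesAlong₁₃ (m₅ l m n))
  -- products with a pure power of `x₁ - x₂`
  have b₁ : ∀ l s t α, P₁ l 0 0 (s, t, α)
      = ∑ᶠ i : ℕ, binomSub l i • W₂.Y a (s + l - i) (W₂.Y b (t + i) (Φ.1 α u)) :=
    fun l s t α => by
      rw [(f₁.family₁₂ 0 0).eq_finsum (fun l => vanishesAlong₁₂ (m₁ l 0 0)), z₁]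
      simp only [index₁₂, add_sub_assoc]
  have b₂ : ∀ l s t α, P₂ l 0 0 (s, t, α)
      = ∑ᶠ i : ℕ, binomNegAdd l i • W₂.Y b (t + l - i) (W₂.Y a (s + i) (Φ.1 α u)) :=
    fun l s t α => by
      rw [(f₂.family₁₂ 0 0).eq_finsum' (fun l => vanishesAlong₁₂ (m₂ l 0 0)), z₂]
      simp only [index₁₂, add_sub_assoc]
  have b₅ : ∀ l s t α, P₅ l 0 0 (s, t, α)
      = Φ.1 α (∑ᶠ i : ℕ, binomSub l i • W₁.Y a (s + l - i) (W₁.Y b (t + i) u)) :=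
    fun l s t α => by
      obtain ⟨N, hN⟩ := W₁.eventually_Y_eq_zero b u t
      have hfin : (Function.support fun i : ℕ =>
          binomSub l i • W₁.Y a (s + l - i) (W₁.Y b (t + i) u)).Finite :=
        finite_support_of_eventually_zero (N := N) fun i hi => by
          rw [hN i (by omega)]
          simp
      rw [(f₅.family₁₂ 0 0).eq_finsum (fun l => vanishesAlong₂₃ (m₅ l 0 0)), z₅,
        map_finsum (Φ.1 α) hfin]
      simp only [index₁₂, add_sub_assoc, map_smul]
  have b₆ : ∀ l s t α, P₆ l 0 0 (s, t, α)
      = Φ.1 α (∑ᶠ i : ℕ, binomNegAdd l i • W₁.Y b (t + l - i) (W₁.Y a (s + i) u)) :=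
    fun l s t α => by
      obtain ⟨N, hN⟩ := W₁.eventually_Y_eq_zero a u s
      have hfin : (Function.support fun i : ℕ =>
          binomNegAdd l i • W₁.Y b (t + l - i) (W₁.Y a (s + i) u)).Finite :=
        finite_support_of_eventually_zero (N := N) fun i hi => by
          rw [hN i (by omega)]
          simp
      rw [(f₆.family₁₂ 0 0).eq_finsum' (fun l => vanishesAlong₂₃ (m₆ l 0 0)), z₆,
        map_finsum (Φ.1 α) hfin]
      simp only [index₁₂, add_sub_assoc, map_smul]
  -- locality kills the differences
  have n₁₂ : ∀ l m n : ℤ, L ≤ l → (P₁ - P₂) l m n = 0 := fun l m n hl =>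
    g₁₂.eq_zero_of₁₂ (funext fun ⟨s, t, α⟩ => by
      change P₁ l 0 0 (s, t, α) - P₂ l 0 0 (s, t, α) = 0
      rw [b₁, b₂, W₂.finsum_binom_eq_of_large hL hl, sub_self])
      (.inl fun m n => v₁₂_₁₃ l m n) (.inl fun m n => v₁₂_₂₃ l m n) m n
  have n₅₆ : ∀ l m n : ℤ, L ≤ l → (P₅ - P₆) l m n = 0 := fun l m n hl =>
    g₅₆.eq_zero_of₁₂ (funext fun ⟨s, t, α⟩ => by
      change P₅ l 0 0 (s, t, α) - P₆ l 0 0 (s, t, α) = 0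
      rw [b₅, b₆, W₁.finsum_binom_eq_of_large hL hl, sub_self])
      (.inr fun m n => v₅₆_₃₁ l m n) (.inr fun m n => v₅₆_₃₂ l m n) m n
  have n₁₃ : ∀ l m n : ℤ, kb ≤ n → (P₁ - P₃) l m n = 0 := fun l m n hn =>
    g₁₃.eq_zero_of₂₃ ((g₁₃.family₂₃ 0 0).eq_zero_of_le (funext fun ⟨s, t, α⟩ => by
      rw [eq_mulSub_pow (g₁₃.family₂₃ 0 0) (index₂₃ s) (W₂.Y a s ∘ₗ LinearMap.applyₗ u)
        (fun t α => W₂.Y b t ∘ₗ Φ.1 α - Φ.1 α ∘ₗ W₁.Y b t)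
        (fun t α => by simp [z₁, z₃]), mulSub_pow_sub_eq_zero hkb]
      simp) hn)
      (.inl fun l m => v₁₃_₁₂ l m n) (.inl fun l m => v₁₃_₁₃ l m n) l m
  have n₄₆ : ∀ l m n : ℤ, kb ≤ n → (P₄ - P₆) l m n = 0 := fun l m n hn =>
    g₄₆.eq_zero_of₂₃ ((g₄₆.family₂₃ 0 0).eq_zero_of_le (funext fun ⟨s, t, α⟩ => by
      rw [eq_mulSub_pow (g₄₆.family₂₃ 0 0) (index₂₃ s) (LinearMap.applyₗ (W₁.Y a s u))
        (fun t α => W₂.Y b t ∘ₗ Φ.1 α - Φ.1 α ∘ₗ W₁.Y b t)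
        (fun t α => by simp [z₄, z₆]), mulSub_pow_sub_eq_zero hkb]
      simp) hn)
      (.inr fun l m => v₄₆_₂₁ l m n) (.inr fun l m => v₄₆_₃₁ l m n) l m
  have n₂₄ : ∀ l m n : ℤ, ka ≤ m → (P₂ - P₄) l m n = 0 := fun l m n hm =>
    g₂₄.eq_zero_of₁₃ ((g₂₄.family₁₃ 0 0).eq_zero_of_le (funext fun ⟨s, t, α⟩ => by
      rw [eq_mulSub_pow (g₂₄.family₁₃ 0 0) (index₁₃ t) (W₂.Y b t ∘ₗ LinearMap.applyₗ u)
        (fun s α => W₂.Y a s ∘ₗ Φ.1 α - Φ.1 α ∘ₗ W₁.Y a s)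
        (fun s α => by simp [z₂, z₄]), mulSub_pow_sub_eq_zero hka]
      simp) hm)
      (.inr fun l n => v₂₄_₂₁ l m n) (.inl fun l n => v₂₄_₂₃ l m n) l n
  have n₃₅ : ∀ l m n : ℤ, ka ≤ m → (P₃ - P₅) l m n = 0 := fun l m n hm =>
    g₃₅.eq_zero_of₁₃ ((g₃₅.family₁₃ 0 0).eq_zero_of_le (funext fun ⟨s, t, α⟩ => by
      rw [eq_mulSub_pow (g₃₅.family₁₃ 0 0) (index₁₃ t) (LinearMap.applyₗ (W₁.Y b t u))
        (fun s α => W₂.Y a s ∘ₗ Φ.1 α - Φ.1 α ∘ₗ W₁.Y a s)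
        (fun s α => by simp [z₃, z₅]), mulSub_pow_sub_eq_zero hka]
      simp) hm)
      (.inl fun l n => v₃₅_₁₂ l m n) (.inr fun l n => v₃₅_₃₂ l m n) l n
  -- with only a power of `x₂ - z`, or only a power of `x₁ - z`, the inner commutator is `circ`
  have c₁₃ : ∀ q s α, (P₁ - P₃) 0 0 q (s, 0, α) = W₂.Y a s ((W₁.circ W₂ b q Φ).1 α u) :=
    fun q s α => by
      rw [circ_apply, map_sub]
      exact congrArg₂ (· - ·)
        (eq_leftAction (f₁.family₂₃ 0 0) (fun n => vanishesAlong₂₃ (m₁ 0 0 n)) (index₂₃ s) W₂ b Φ u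
          (W₂.Y a s) (fun t α => by rw [z₁]) q α)
        (eq_rightAction (f₃.family₂₃ 0 0) (fun n => vanishesAlong₂₃ (m₃ 0 0 n)) (index₂₃ s) W₁ b Φ u
          (W₂.Y a s) (fun t α => by rw [z₃]) q α)
  have c₄₆ : ∀ q s α, (P₄ - P₆) 0 0 q (s, 0, α) = (W₁.circ W₂ b q Φ).1 α (W₁.Y a s u) :=
    fun q s α => by
      rw [circ_apply]
      exact congrArg₂ (· - ·)
        (eq_leftAction (f₄.family₂₃ 0 0) (fun n => vanishesAlong₁₂ (m₄ 0 0 n)) (index₂₃ s) W₂ b Φ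
          (W₁.Y a s u) LinearMap.id (fun t α => by rw [z₄]; rfl) q α)
        (eq_rightAction (f₆.family₂₃ 0 0) (fun n => vanishesAlong₁₂ (m₆ 0 0 n)) (index₂₃ s) W₁ b Φ
          (W₁.Y a s u) LinearMap.id (fun t α => by rw [z₆]; rfl) q α)
  have c₂₄ : ∀ p t α, (P₂ - P₄) 0 p 0 (0, t, α) = W₂.Y b t ((W₁.circ W₂ a p Φ).1 α u) :=
    fun p t α => by
      rw [circ_apply, map_sub]
      exact congrArg₂ (· - ·)
        (eq_leftAction (f₂.family₁₃ 0 0) (fun m => vanishesAlong₂₃ (m₂ 0 m 0)) (index₁₃ t) W₂ a Φ u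
          (W₂.Y b t) (fun s α => by rw [z₂]) p α)
        (eq_rightAction (f₄.family₁₃ 0 0) (fun m => vanishesAlong₂₃ (m₄ 0 m 0)) (index₁₃ t) W₁ a Φ u
          (W₂.Y b t) (fun s α => by rw [z₄]) p α)
  have c₃₅ : ∀ p t α, (P₃ - P₅) 0 p 0 (0, t, α) = (W₁.circ W₂ a p Φ).1 α (W₁.Y b t u) :=
    fun p t α => by
      rw [circ_apply]
      exact congrArg₂ (· - ·)
        (eq_leftAction (f₃.family₁₃ 0 0) (fun m => vanishesAlong₁₂ (m₃ 0 m 0)) (index₁₃ t) W₂ a Φ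
          (W₁.Y b t u) LinearMap.id (fun s α => by rw [z₃]; rfl) p α)
        (eq_rightAction (f₅.family₁₃ 0 0) (fun m => vanishesAlong₁₂ (m₅ 0 m 0)) (index₁₃ t) W₁ a Φ
          (W₁.Y b t u) LinearMap.id (fun s α => by rw [z₅]; rfl) p α)
  -- `S = a(bΦ - Φb) - (bΦ - Φb)a` and `T = b(aΦ - Φa) - (aΦ - Φa)b`
  refine ⟨(P₁ - P₃) - (P₄ - P₆), (P₂ - P₄) - (P₃ - P₅),
    ⟨g₁₃.sub g₄₆, g₂₄.sub g₃₅, ?_, ?_, ?_, ?_⟩, ?_, ?_, ?_⟩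
  · intro p q α
    rw [circ_apply]
    exact congrArg₂ (· - ·)
      (eq_leftAction (g₁₃.family₁₃ 0 q) (fun m => v₁₃_₁₃ 0 m q) (index₁₃ 0) W₂ a _ u LinearMap.id
        (c₁₃ q) p α)
      (eq_rightAction (g₄₆.family₁₃ 0 q) (fun m => v₄₆_₃₁ 0 m q) (index₁₃ 0) W₁ a _ u LinearMap.id
        (c₄₆ q) p α)
  · intro p q α
    rw [circ_apply]
    exact congrArg₂ (· - ·)
      (eq_leftAction (g₂₄.family₂₃ 0 p) (fun n => v₂₄_₂₃ 0 p n) (index₂₃ 0) W₂ b _ u LinearMap.id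
        (c₂₄ p) q α)
      (eq_rightAction (g₃₅.family₂₃ 0 p) (fun n => v₃₅_₃₂ 0 p n) (index₂₃ 0) W₁ b _ u LinearMap.id
        (c₃₅ p) q α)
  · exact fun q s α => congrArg₂ (· - ·) (c₁₃ q s α) (c₄₆ q s α)
  · intro l n α
    have h₁₂ := eq_leftAction (g₁₂.family₂₃ l 0) (fun n => v₁₂_₂₃ l 0 n) (index₂₃ 0) W₂
      (𝒱.Y a l b) Φ u LinearMap.id (fun t α => by
        change P₁ l 0 0 (0, t, α) - P₂ l 0 0 (0, t, α) = _
        rw [b₁, b₂]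
        simp only [zero_add]
        rw [W₂.finsum_binom_sub_eq_Y, LinearMap.id_apply]) n α
    have h₅₆ := eq_rightAction (g₅₆.family₂₃ l 0) (fun n => v₅₆_₃₂ l 0 n) (index₂₃ 0) W₁
      (𝒱.Y a l b) Φ u LinearMap.id (fun t α => by
        change P₅ l 0 0 (0, t, α) - P₆ l 0 0 (0, t, α) = _
        rw [b₅, b₆, ← map_sub]
        simp only [zero_add]
        rw [W₁.finsum_binom_sub_eq_Y, LinearMap.id_apply]) n α
    rw [circ_apply]
    refine Eq.trans ?_ (congrArg₂ (· - ·) h₁₂ h₅₆)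
    simp only [Pi.sub_apply]
    abel
  · intro l m n hn
    change (P₁ - P₃) l m n - (P₄ - P₆) l m n = 0
    rw [n₁₃ l m n hn, n₄₆ l m n hn, sub_zero]
  · intro l m n hm
    change (P₂ - P₄) l m n - (P₃ - P₅) l m n = 0
    rw [n₂₄ l m n hm, n₃₅ l m n hm, sub_zero]
  · intro l m n hl
    have h₁₂ := n₁₂ l m n hl
    have h₅₆ := n₅₆ l m n hl
    simp only [Pi.sub_apply, sub_eq_zero] at h₁₂ h₅₆ ⊢
    rw [h₁₂, h₅₆]
    abel

end VOAModule

/-! ### Derivatives of binomial expansions -/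

theorem succ_mul_choose_succ (n : ℤ) (i : ℕ) :
    ((i : ℂ) + 1) * ((Ring.choose n (i + 1) : ℤ) : ℂ)
      = ((n : ℂ) - i) * ((Ring.choose n i : ℤ) : ℂ) := by
  have h := Ring.choose_smul_choose n (Nat.le_succ i)
  rw [Nat.succ_eq_add_one, Nat.choose_succ_self_right, Nat.add_sub_cancel_left,
    Ring.choose_one_right, nsmul_eq_mul] at h
  have h' := congrArg (fun z : ℤ => (z : ℂ)) h
  push_cast at h'
  rw [h', mul_comm]

theorem succ_mul_choose_succ' (n : ℤ) (i : ℕ) :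
    ((i : ℂ) + 1) * ((Ring.choose n (i + 1) : ℤ) : ℂ)
      = (n : ℂ) * ((Ring.choose (n - 1) i : ℤ) : ℂ) := by
  have h := Ring.choose_smul_choose n (Nat.le_add_left 1 i)
  rw [Nat.choose_one_right, Nat.add_sub_cancel, Ring.choose_one_right, nsmul_eq_mul,
    Nat.cast_one] at h
  have h' := congrArg (fun z : ℤ => (z : ℂ)) h
  push_cast at h'
  exact h'

theorem succ_mul_binomSub_succ (n : ℤ) (i : ℕ) :
    ((i : ℂ) + 1) * binomSub n (i + 1) = -(((n : ℂ) - i) * binomSub n i) := by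
  simp only [binomSub, pow_succ]
  linear_combination -(-1 : ℂ) ^ i * succ_mul_choose_succ n i

theorem sub_mul_binomSub (n : ℤ) (i : ℕ) :
    ((n : ℂ) - i) * binomSub n i = n * binomSub (n - 1) i := by
  simp only [binomSub]
  linear_combination (-1 : ℂ) ^ i * (succ_mul_choose_succ' n i - succ_mul_choose_succ n i)

theorem succ_mul_binomNegAdd_succ (n : ℤ) (i : ℕ) :
    ((i : ℂ) + 1) * binomNegAdd n (i + 1) = -(((n : ℂ) - i) * binomNegAdd n i) := by
  simp only [binomNegAdd_eq]
  linear_combination (-1 : ℂ) ^ n * succ_mul_binomSub_succ n i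

theorem succ_mul_binomNegAdd_succ' (n : ℤ) (i : ℕ) :
    ((i : ℂ) + 1) * binomNegAdd n (i + 1) = n * binomNegAdd (n - 1) i := by
  have h : (-1 : ℂ) ^ n = -(-1) ^ (n - 1) := by
    rw [zpow_sub_one₀ (by norm_num)]
    norm_num
  rw [succ_mul_binomNegAdd_succ]
  simp only [binomNegAdd_eq, h]
  linear_combination (-1 : ℂ) ^ (n - 1) * sub_mul_binomSub n i

namespace VOAModule

variable {V : Type*} [AddCommGroup V] [Module ℂ V] {𝒱 : VertexOperatorAlgebra V}
  {M₁ M₂ : Type*} [AddCommGroup M₁] [Module ℂ M₁] [AddCommGroup M₂] [Module ℂ M₂]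
  {W₁ : VOAModule 𝒱 M₁} {W₂ : VOAModule 𝒱 M₂}

/-! ### Linearity -/

theorem circ_add (a : V) (m : ℤ) (Φ Ψ : truncSeries M₁ M₂) :
    W₁.circ W₂ a m (Φ + Ψ) = W₁.circ W₂ a m Φ + W₁.circ W₂ a m Ψ := by
  refine Subtype.ext (funext fun α => LinearMap.ext fun u => ?_)
  have h1 : W₂.leftAction a m (Φ + Ψ) α u
      = W₂.leftAction a m Φ α u + W₂.leftAction a m Ψ α u := by
    simp only [leftAction_apply]
    rw [← finsum_add_distrib (finite_support_leftAction W₂ a m Φ α u)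
      (finite_support_leftAction W₂ a m Ψ α u)]
    simp
  have h2 : W₁.rightAction a m (Φ + Ψ) α u
      = W₁.rightAction a m Φ α u + W₁.rightAction a m Ψ α u := by
    simp only [rightAction_apply]
    rw [← finsum_add_distrib (finite_support_rightAction W₁ a m Φ α u)
      (finite_support_rightAction W₁ a m Ψ α u)]
    simp
  change _ = (W₁.circ W₂ a m Φ).1 α u + (W₁.circ W₂ a m Ψ).1 α u
  rw [circ_apply, circ_apply, circ_apply, h1, h2]
  abel

theorem circ_smul (a : V) (m : ℤ) (c : ℂ) (Φ : truncSeries M₁ M₂) :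
    W₁.circ W₂ a m (c • Φ) = c • W₁.circ W₂ a m Φ := by
  refine Subtype.ext (funext fun α => LinearMap.ext fun u => ?_)
  have h1 : W₂.leftAction a m (c • Φ) α u = c • W₂.leftAction a m Φ α u := by
    simp only [leftAction_apply, smul_finsum]
    simp [smul_comm c]
  have h2 : W₁.rightAction a m (c • Φ) α u = c • W₁.rightAction a m Φ α u := by
    simp only [rightAction_apply, smul_finsum]
    simp [smul_comm c]
  change _ = c • (W₁.circ W₂ a m Φ).1 α u
  rw [circ_apply, circ_apply, h1, h2, smul_sub]

theorem circ_add_left (a b : V) (m : ℤ) (Φ : truncSeries M₁ M₂) :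
    W₁.circ W₂ (a + b) m Φ = W₁.circ W₂ a m Φ + W₁.circ W₂ b m Φ := by
  refine Subtype.ext (funext fun α => LinearMap.ext fun u => ?_)
  have h1 : W₂.leftAction (a + b) m Φ α u
      = W₂.leftAction a m Φ α u + W₂.leftAction b m Φ α u := by
    simp only [leftAction_apply]
    rw [← finsum_add_distrib (finite_support_leftAction W₂ a m Φ α u)
      (finite_support_leftAction W₂ b m Φ α u)]
    simp
  have h2 : W₁.rightAction (a + b) m Φ α u
      = W₁.rightAction a m Φ α u + W₁.rightAction b m Φ α u := by
    simp only [rightAction_apply]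
    rw [← finsum_add_distrib (finite_support_rightAction W₁ a m Φ α u)
      (finite_support_rightAction W₁ b m Φ α u)]
    simp
  change _ = (W₁.circ W₂ a m Φ).1 α u + (W₁.circ W₂ b m Φ).1 α u
  rw [circ_apply, circ_apply, circ_apply, h1, h2]
  abel

theorem circ_smul_left (c : ℂ) (a : V) (m : ℤ) (Φ : truncSeries M₁ M₂) :
    W₁.circ W₂ (c • a) m Φ = c • W₁.circ W₂ a m Φ := by
  refine Subtype.ext (funext fun α => LinearMap.ext fun u => ?_)
  have h1 : W₂.leftAction (c • a) m Φ α u = c • W₂.leftAction a m Φ α u := by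
    simp only [leftAction_apply, smul_finsum]
    simp [smul_comm c]
  have h2 : W₁.rightAction (c • a) m Φ α u = c • W₁.rightAction a m Φ α u := by
    simp only [rightAction_apply, smul_finsum]
    simp [smul_comm c]
  change _ = c • (W₁.circ W₂ a m Φ).1 α u
  rw [circ_apply, circ_apply, h1, h2, smul_sub]

/-! ### Vacuum and derivatives -/

theorem circ_vac (n : ℤ) (Φ : truncSeries M₁ M₂) :
    W₁.circ W₂ 𝒱.vac n Φ = if n = -1 then Φ else 0 := by
  refine Subtype.ext (funext fun α => LinearMap.ext fun u => ?_)
  have h2 : W₁.rightAction 𝒱.vac n Φ α u = 0 := by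
    rw [rightAction_apply]
    refine finsum_eq_zero_of_forall_eq_zero fun i => ?_
    rw [W₁.isWeakModule.Y_vac, if_neg (by omega)]
    simp
  rw [circ_apply, h2, sub_zero, leftAction_apply]
  simp only [W₂.isWeakModule.Y_vac]
  split_ifs with hn
  · subst hn
    rw [finsum_eq_single _ 0 fun i hi => by rw [if_neg (by omega)]; simp]
    simp [binomSub_zero_right]
  · refine finsum_eq_zero_of_forall_eq_zero fun i => ?_
    by_cases hi : n - i = -1
    · -- here `i = n + 1 > n ≥ 0`, so that the binomial coefficient vanishes
      obtain ⟨k, rfl⟩ : ∃ k : ℕ, n = k := ⟨i - 1, by omega⟩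
      have hik : k < i := by omega
      rw [binomSub, Ring.choose_natCast, Nat.choose_eq_zero_of_lt hik]
      simp
    · rw [if_neg hi]
      simp

theorem circ_derivative (a : V) (n : ℤ) (Φ : truncSeries M₁ M₂) :
    W₁.circ W₂ (𝒱.Y 𝒱.omega 0 a) n Φ = (-(n : ℂ)) • W₁.circ W₂ a (n - 1) Φ := by
  refine Subtype.ext (funext fun α => LinearMap.ext fun u => ?_)
  change _ = (-(n : ℂ)) • (W₁.circ W₂ a (n - 1) Φ).1 α u
  have h1 : W₂.leftAction (𝒱.Y 𝒱.omega 0 a) n Φ α u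
      = (-(n : ℂ)) • W₂.leftAction a (n - 1) Φ α u := by
    simp only [leftAction_apply, smul_finsum, W₂.isWeakModule.derivative]
    refine finsum_congr fun i => ?_
    rw [LinearMap.smul_apply, smul_smul, smul_smul, sub_right_comm n 1]
    congr 1
    push_cast
    linear_combination -sub_mul_binomSub n i
  have h2 : W₁.rightAction (𝒱.Y 𝒱.omega 0 a) n Φ α u
      = (-(n : ℂ)) • W₁.rightAction a (n - 1) Φ α u := by
    obtain ⟨N, hN⟩ := W₁.eventually_Y_eq_zero a u 0
    simp only [zero_add] at hN
    simp only [rightAction_apply, smul_finsum, W₁.isWeakModule.derivative]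
    rw [finsum_eq_sum_range (N := N + 1) fun k hk => by
        obtain ⟨k, rfl⟩ : ∃ j, k = j + 1 := ⟨k - 1, by omega⟩
        rw [show ((k + 1 : ℕ) : ℤ) - 1 = k by push_cast; ring, LinearMap.smul_apply,
          hN k (by omega)]
        simp,
      finsum_eq_sum_range (N := N) fun k hk => by rw [hN k hk]; simp,
      Finset.sum_range_succ']
    simp only [Nat.cast_zero, Int.cast_zero, neg_zero, zero_smul, LinearMap.zero_apply, map_zero,
      smul_zero, add_zero]
    refine Finset.sum_congr rfl fun i _ => ?_
    have e1 : ((i + 1 : ℕ) : ℤ) - 1 = i := by push_cast; ring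
    have e2 : α + n - ((i + 1 : ℕ) : ℂ) = α + ((n - 1 : ℤ) : ℂ) - i := by push_cast; ring
    rw [e1, e2, LinearMap.smul_apply, map_smul, smul_smul, smul_smul]
    congr 1
    push_cast
    linear_combination -succ_mul_binomNegAdd_succ' n i
  rw [circ_apply, circ_apply, h1, h2, smul_sub]

/-- `[L(-1), a_n] = -n a_{n-1}` on a module. -/
theorem commutator_omega (W : VOAModule 𝒱 M₁) (a : V) (n : ℤ) (w : M₁) :
    W.Y 𝒱.omega 0 (W.Y a n w) - W.Y a n (W.Y 𝒱.omega 0 w) = (-(n : ℂ)) • W.Y a (n - 1) w := by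
  have h := W.finsum_binom_sub_eq_Y 𝒱.omega a 0 n w
  rw [W.isWeakModule.derivative, LinearMap.smul_apply] at h
  rw [← h, finsum_eq_single _ 0 fun i hi => by
      obtain ⟨j, rfl⟩ := Nat.exists_eq_succ_of_ne_zero hi
      rw [Nat.succ_eq_add_one, binomSub_zero_succ, zero_smul],
    finsum_eq_single _ 0 fun i hi => by
      obtain ⟨j, rfl⟩ := Nat.exists_eq_succ_of_ne_zero hi
      rw [Nat.succ_eq_add_one, binomNegAdd_eq, binomSub_zero_succ, mul_zero, zero_smul]]
  simp [binomNegAdd_eq, binomSub_zero_right]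

theorem leftAction_omega {Φ : truncSeries M₁ M₂} (hΦ : HasDerivBracket W₁ W₂ Φ.1) (a : V) (m : ℤ)
    (α : ℂ) (u : M₁) :
    W₂.Y 𝒱.omega 0 (W₂.leftAction a m Φ α u) - W₂.leftAction a m Φ α (W₁.Y 𝒱.omega 0 u)
      = (-α) • W₂.leftAction a m Φ (α - 1) u := by
  obtain ⟨N₀, h₀⟩ := eventually_coeff_eq_zero Φ α u
  obtain ⟨N₁, h₁⟩ := eventually_coeff_eq_zero Φ α (W₁.Y 𝒱.omega 0 u)
  obtain ⟨N₂, h₂⟩ := eventually_coeff_eq_zero Φ (α - 1) u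
  simp only [leftAction_apply]
  rw [map_finsum _ (finite_support_leftAction W₂ a m Φ α u), smul_finsum,
    finsum_eq_sum_range (N := N₀ + N₁ + N₂) fun k hk => by rw [h₀ k (by omega)]; simp,
    finsum_eq_sum_range (N := N₀ + N₁ + N₂) fun k hk => by rw [h₁ k (by omega)]; simp,
    finsum_eq_sum_range (N := N₀ + N₁ + N₂) fun k hk => by rw [h₂ k (by omega)]; simp,
    ← Finset.sum_sub_distrib, ← sub_eq_zero, ← Finset.sum_sub_distrib]
  -- the terms that are left over telescope
  refine (Finset.sum_congr rfl fun i _ => ?_).trans ((Finset.sum_range_sub (fun i : ℕ =>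
    ((i : ℂ) * binomSub m i) • W₂.Y a (m - i) (Φ.1 (α - 1 + i) u)) _).trans ?_)
  · have hb := congrArg (fun f => f u) (hΦ (α + i))
    simp only [LinearMap.sub_apply, LinearMap.comp_apply, LinearMap.smul_apply] at hb
    have hb' := congrArg (W₂.Y a (m - i)) hb
    rw [map_sub, map_smul, sub_eq_iff_eq_add] at hb'
    have hc := commutator_omega W₂ a (m - i) (Φ.1 (α + i) u)
    rw [hb', sub_eq_iff_eq_add] at hc
    have e1 : m - ((i + 1 : ℕ) : ℤ) = m - i - 1 := by push_cast; ring
    have e2 : α - 1 + ((i + 1 : ℕ) : ℂ) = α + i := by push_cast; ring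
    have e3 : α - 1 + (i : ℂ) = α + i - 1 := by ring
    have hs := succ_mul_binomSub_succ m i
    rw [map_smul, hc, e1, e2, e3]
    push_cast at hs ⊢
    rw [hs]
    module
  · rw [h₂ _ (by omega)]
    simp

theorem rightAction_omega {Φ : truncSeries M₁ M₂} (hΦ : HasDerivBracket W₁ W₂ Φ.1) (a : V) (m : ℤ)
    (α : ℂ) (u : M₁) :
    W₂.Y 𝒱.omega 0 (W₁.rightAction a m Φ α u) - W₁.rightAction a m Φ α (W₁.Y 𝒱.omega 0 u)
      = (-α) • W₁.rightAction a m Φ (α - 1) u := by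
  obtain ⟨N₀, h₀⟩ := W₁.eventually_Y_eq_zero a u 0
  obtain ⟨N₁, h₁⟩ := W₁.eventually_Y_eq_zero a (W₁.Y 𝒱.omega 0 u) 0
  simp only [zero_add] at h₀ h₁
  simp only [rightAction_apply]
  rw [map_finsum _ (finite_support_rightAction W₁ a m Φ α u), smul_finsum,
    finsum_eq_sum_range (N := N₀ + N₁ + 1) fun k hk => by rw [h₀ k (by omega)]; simp,
    finsum_eq_sum_range (N := N₀ + N₁ + 1) fun k hk => by rw [h₁ k (by omega)]; simp,
    finsum_eq_sum_range (N := N₀ + N₁ + 1) fun k hk => by rw [h₀ k (by omega)]; simp,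
    ← Finset.sum_sub_distrib, ← sub_eq_zero, ← Finset.sum_sub_distrib]
  -- the terms that are left over telescope
  refine (Finset.sum_congr rfl fun i _ => ?_).trans ((Finset.sum_range_sub (fun i : ℕ =>
    ((i : ℂ) * binomNegAdd m i) • Φ.1 (α + m - i) (W₁.Y a (i - 1) u)) _).trans ?_)
  · have hb := congrArg (fun f => f (W₁.Y a i u)) (hΦ (α + m - i))
    simp only [LinearMap.sub_apply, LinearMap.comp_apply, LinearMap.smul_apply] at hb
    have hc := congrArg (Φ.1 (α + m - i)) (commutator_omega W₁ a i u)
    rw [map_sub, map_smul, sub_eq_iff_eq_add] at hc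
    rw [hc, sub_eq_iff_eq_add] at hb
    have e1 : ((i + 1 : ℕ) : ℤ) - 1 = i := by push_cast; ring
    have e2 : α + m - ((i + 1 : ℕ) : ℂ) = α + m - i - 1 := by push_cast; ring
    have e3 : α - 1 + m - (i : ℂ) = α + m - i - 1 := by ring
    have hs := succ_mul_binomNegAdd_succ m i
    rw [map_smul, hb, e1, e2, e3]
    push_cast at hs ⊢
    rw [hs]
    module
  · rw [show ((N₀ + N₁ + 1 : ℕ) : ℤ) - 1 = ((N₀ + N₁ : ℕ) : ℤ) by push_cast; ring,
      h₀ _ (by omega)]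
    simp

theorem hasDerivBracket_circ {Φ : truncSeries M₁ M₂} (hΦ : HasDerivBracket W₁ W₂ Φ.1) (a : V)
    (m : ℤ) : HasDerivBracket W₁ W₂ (W₁.circ W₂ a m Φ).1 := fun α => by
  refine LinearMap.ext fun u => ?_
  simp only [LinearMap.sub_apply, LinearMap.comp_apply, LinearMap.smul_apply, circ_apply, map_sub,
    smul_sub]
  rw [← leftAction_omega hΦ a m α u, ← rightAction_omega hΦ a m α u]
  abel

/-! ### Consequences of locality -/

/-- The argument of Dong's lemma: `(x₁ - z)^m` with large `m` expands into products of a power of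
`x₁ - x₂` and a power of `x₂ - z` one of which is large. -/
theorem IsCommutatorPair.eq_zero_of_large {a b : V} {Φ : truncSeries M₁ M₂} {u : M₁}
    {S T : ℤ → ℤ → ℤ → TripleIndex → M₂} (h : IsCommutatorPair W₁ W₂ a b Φ u S T)
    {k₁₂ k₁₃ k₂₃ : ℤ} (hS : ∀ l m n : ℤ, k₂₃ ≤ n → S l m n = 0)
    (hT : ∀ l m n : ℤ, k₁₃ ≤ m → T l m n = 0) (hST : ∀ l m n : ℤ, k₁₂ ≤ l → S l m n = T l m n)
    (r : ℕ) (l m n : ℤ) (hr : (k₁₂ - l).toNat + (k₂₃ - n).toNat ≤ r) (hm : k₁₃ + r ≤ m) :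
    S l m n = 0 := by
  induction r generalizing l m n with
  | zero => exact hS l m n (by omega)
  | succ r ih =>
    by_cases hn : k₂₃ ≤ n
    · exact hS l m n hn
    by_cases hl : k₁₂ ≤ l
    · rw [hST l m n hl, hT l m n (by omega)]
    funext i
    have hrec := h.familyS.recursion l (m - 1) n i
    rw [sub_add_cancel, ih (l + 1) (m - 1) n (by omega) (by omega),
      ih l (m - 1) (n + 1) (by omega) (by omega)] at hrec
    simpa using hrec.symm

theorem isLocal_circ {Φ : truncSeries M₁ M₂} (hΦ : IsLocal W₁ W₂ Φ.1) (b : V) (q : ℤ) :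
    IsLocal W₁ W₂ (W₁.circ W₂ b q Φ).1 := fun a => by
  obtain ⟨k₁₂, k₁₃, k₂₃, hk⟩ := exists_isCommutatorPair W₁ W₂ a b hΦ
  set r : ℕ := k₁₂.toNat + (k₂₃ - q).toNat with hr
  refine ⟨(k₁₃ + r).toNat + 1, Nat.succ_pos _, ?_⟩
  rw [← sub_eq_zero, ← map_sub]
  refine funext fun s => funext fun α => LinearMap.ext fun u => ?_
  obtain ⟨S, T, h, hS, hT, hST⟩ := hk u
  have h0 := h.eq_zero_of_large hS hT hST r 0 (((k₁₃ + r).toNat + 1 : ℕ) : ℤ) q (by omega)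
    (by omega)
  have hpow := eq_mulSub_pow (h.familyS.family₁₃ 0 q) (index₁₃ 0) (LinearMap.applyₗ u)
    (fun s α => W₂.Y a s ∘ₗ (W₁.circ W₂ b q Φ).1 α - (W₁.circ W₂ b q Φ).1 α ∘ₗ W₁.Y a s)
    (fun s α => h.S_commutator q s α) ((k₁₃ + r).toNat + 1) s α
  simp only [h0] at hpow
  exact hpow.symm

theorem eventually_circ_eq_zero {Φ : truncSeries M₁ M₂} (hΦ : IsLocal W₁ W₂ Φ.1) (a : V) :
    ∃ N : ℤ, ∀ n, N ≤ n → W₁.circ W₂ a n Φ = 0 := by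
  -- apply the commutator pair of `a` and the vacuum
  obtain ⟨k₁₂, k₁₃, k₂₃, hk⟩ := exists_isCommutatorPair W₁ W₂ a 𝒱.vac hΦ
  refine ⟨k₁₃, fun n hn => Subtype.ext (funext fun α => LinearMap.ext fun u => ?_)⟩
  obtain ⟨S, T, h, -, hT, -⟩ := hk u
  have h' := h.T_circ n (-1) α
  rw [hT 0 n (-1) hn, circ_vac, if_pos rfl] at h'
  exact h'.symm

/-- The Jacobi identity for the coefficients, on a local series. -/
theorem circ_jacobi {Φ : truncSeries M₁ M₂} (hΦ : IsLocal W₁ W₂ Φ.1) (a b : V) (l m n : ℤ) (α : ℂ)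
    (u : M₁) :
    (∑ᶠ i : ℕ, binomSub l i • (W₁.circ W₂ a (m + l - i) (W₁.circ W₂ b (n + i) Φ)).1 α u)
      - (∑ᶠ i : ℕ, binomNegAdd l i • (W₁.circ W₂ b (n + l - i) (W₁.circ W₂ a (m + i) Φ)).1 α u)
    = ∑ᶠ i : ℕ, ((Ring.choose m i : ℤ) : ℂ) •
        (W₁.circ W₂ (𝒱.Y a (l + i) b) (m + n - i) Φ).1 α u := by
  obtain ⟨k₁₂, k₁₃, k₂₃, hk⟩ := exists_isCommutatorPair W₁ W₂ a b hΦ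
  obtain ⟨S, T, h, hS, hT, hST⟩ := hk u
  have h1 := eq_finsum_binomSub (G := fun l m n => S l m n (0, 0, α))
    (fun l m n => h.familyS.recursion l m n _)
    (fun l m n => ⟨(k₂₃ - n).toNat, fun k hk => by rw [hS _ _ _ (by omega)]; rfl⟩) l m n
  have h2 := eq_finsum_binomNegAdd (G := fun l m n => T l m n (0, 0, α))
    (fun l m n => h.familyT.recursion l m n _)
    (fun l m n => ⟨(k₁₃ - m).toNat, fun k hk => by rw [hT _ _ _ (by omega)]; rfl⟩) l m n
  have h3 := eq_finsum_choose (G := fun l m n => S l m n (0, 0, α) - T l m n (0, 0, α))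
    (fun l m n => by
      rw [h.familyS.recursion, h.familyT.recursion]
      abel)
    (fun l m n => ⟨(k₁₂ - l).toNat, fun k hk => by rw [hST _ _ _ (by omega), sub_self]⟩) l m n
  simp only [h.S_circ] at h1
  simp only [h.T_circ] at h2
  simp only [h.S_sub_T] at h3
  rw [← h1, ← h2, ← h3]

/-- A subspace of local series that is stable under the operators `a(m)∘` is a weak module. -/
theorem exists_isWeakModule (W₁ : VOAModule 𝒱 M₁) (W₂ : VOAModule 𝒱 M₂)
    (N : Submodule ℂ (truncSeries M₁ M₂)) (hlocal : ∀ Φ ∈ N, IsLocal W₁ W₂ Φ.1)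
    (hstable : ∀ (a : V) (m : ℤ), ∀ Φ ∈ N, W₁.circ W₂ a m Φ ∈ N) :
    ∃ YN : ModeMap V N,
      (∀ (a : V) (m : ℤ) (Φ : N), (YN a m Φ : truncSeries M₁ M₂) = W₁.circ W₂ a m Φ) ∧
      IsWeakModule 𝒱 YN := by
  let YN : ModeMap V N :=
    { toFun := fun a m =>
        { toFun := fun Φ => ⟨W₁.circ W₂ a m Φ, hstable a m Φ Φ.2⟩
          map_add' := fun Φ Ψ => Subtype.ext (circ_add a m Φ.1 Ψ.1)
          map_smul' := fun c Φ => Subtype.ext (circ_smul a m c Φ.1) }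
      map_add' := fun a b => funext fun m => LinearMap.ext fun Φ =>
        Subtype.ext (circ_add_left a b m Φ.1)
      map_smul' := fun c a => funext fun m => LinearMap.ext fun Φ =>
        Subtype.ext (circ_smul_left c a m Φ.1) }
  have hYN : ∀ (a : V) (m : ℤ) (Φ : N), (YN a m Φ : truncSeries M₁ M₂) = W₁.circ W₂ a m Φ :=
    fun _ _ _ => rfl
  have htrunc : IsTruncated YN := fun a Φ => by
    obtain ⟨K, hK⟩ := eventually_circ_eq_zero (hlocal Φ Φ.2) a
    exact ⟨K, fun n hn => Subtype.ext (hK n hn)⟩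
  refine ⟨YN, hYN, ⟨fun n => ?_, fun a n => ?_, htrunc, fun a b Φ l m n => ?_⟩⟩
  · refine LinearMap.ext fun Φ => Subtype.ext ?_
    rw [hYN, circ_vac]
    split_ifs <;> rfl
  · exact LinearMap.ext fun Φ => Subtype.ext (circ_derivative a n Φ.1)
  · refine Subtype.ext (Subtype.ext (funext fun α => LinearMap.ext fun u => ?_))
    let ev : N →ₗ[ℂ] M₂ := LinearMap.applyₗ u ∘ₗ LinearMap.proj α ∘ₗ
      (truncSeries M₁ M₂).subtype ∘ₗ N.subtype
    obtain ⟨K₁, hK₁⟩ := htrunc b Φ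
    obtain ⟨K₂, hK₂⟩ := htrunc a Φ
    obtain ⟨K₃, hK₃⟩ := 𝒱.truncated a b
    have f₁ : (Function.support fun i : ℕ =>
        binomSub l i • YN a (m + l - i) (YN b (n + i) Φ)).Finite :=
      finite_support_of_eventually_zero (M := N) (N := K₁ - n) fun i hi => by
        rw [hK₁ _ (by omega), map_zero, smul_zero]
    have f₂ : (Function.support fun i : ℕ =>
        binomNegAdd l i • YN b (n + l - i) (YN a (m + i) Φ)).Finite :=
      finite_support_of_eventually_zero (M := N) (N := K₂ - m) fun i hi => by
        rw [hK₂ _ (by omega), map_zero, smul_zero]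
    have f₃ : (Function.support fun i : ℕ =>
        ((Ring.choose m i : ℤ) : ℂ) • YN (𝒱.Y a (l + i) b) (m + n - i) Φ).Finite :=
      finite_support_of_eventually_zero (M := N) (N := K₃ - l) fun i hi => by
        rw [hK₃ _ (by omega), map_zero]
        simp
    have hev : ∀ Ψ : N, Ψ.1.1 α u = ev Ψ := fun _ => rfl
    rw [hev, hev, map_sub, map_finsum ev f₁, map_finsum ev f₂, map_finsum ev f₃]
    simp only [map_smul]
    exact circ_jacobi (hlocal Φ Φ.2) a b l m n α u

end VOAModule

theorem theorem4p6 {V M₁ M₂ : Type*} [AddCommGroup V] [Module ℂ V]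
    [AddCommGroup M₁] [Module ℂ M₁] [AddCommGroup M₂] [Module ℂ M₂]
    (𝒱 : VertexOperatorAlgebra V) (W₁ : VOAModule 𝒱 M₁) (W₂ : VOAModule 𝒱 M₂) :
    (∃ YE : ModeMap V (W₁.localSeries W₂),
      (∀ (a : V) (m : ℤ) (Φ : W₁.localSeries W₂),
        (YE a m Φ : truncSeries M₁ M₂) = W₁.circ W₂ a m Φ) ∧
      IsWeakModule 𝒱 YE) ∧
    (∃ YG : ModeMap V (W₁.genIntertwining W₂),
      (∀ (a : V) (m : ℤ) (Φ : W₁.genIntertwining W₂),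
        (YG a m Φ : truncSeries M₁ M₂) = W₁.circ W₂ a m Φ) ∧
      IsWeakModule 𝒱 YG) :=
  ⟨VOAModule.exists_isWeakModule W₁ W₂ (W₁.localSeries W₂) (fun _ hΦ => hΦ)
      fun a m _ hΦ => VOAModule.isLocal_circ hΦ a m,
    VOAModule.exists_isWeakModule W₁ W₂ (W₁.genIntertwining W₂) (fun _ hΦ => hΦ.2)
      fun a m _ hΦ => ⟨VOAModule.hasDerivBracket_circ hΦ.1 a m, VOAModule.isLocal_circ hΦ.2 a m⟩⟩
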